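/- Let $x_{t+1}=Ax_t+B_uu_t+B_ww_t$, $s_t=Cx_t$ ($t\in\mathbb Z$) be a real linear system with state in $\mathbb R^{d_x}$, input $u_t\in\mathbb R^{d_u}$, output $s_t\in\mathbb R^{d_s}$ and scalar disturbance $w_t\in\mathbb R$ ($d_w=1$), with $(A,B_u)$ stabilizable and $(A,C)$ observable. Put $F(z)=C(zI-A)^{-1}B_u$, $G(z)=C(zI-A)^{-1}B_w$ and $K_\circ=-(I+F^*F)^{-1}F^*G$ on the unit circle. Let $\Delta$ be a canonical spectral factor, $\Delta^*\Delta=I+F^*F$ with $\Delta$, $\Delta^{-1}$ causal; let $\{\cdot\}_+$ and $\{\cdot\}_-$ denote causal and strictly anticausal parts, and $K_{H_2}=\Delta^{-1}\{\Delta K_\circ\}_+$. (If $A$ is not stable, causality of $\Delta$, $\Delta^{-1}$ and $\{\Delta K_\circ\}_+$ is understood relative to the plant: $\Delta$ maps the stable causal inputs $v$ for which $(zI-A)^{-1}B_uv$ is stable and causal to stable causal signals, $\Delta^{-1}$ maps stable causal signals to such inputs, and $K_{H_2}$ is a stable causal control law under which the state depends on $w$ through a stable causal operator.) Let $P(z)=p_0+\sum_{k=1}^m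 p_k(z^k+z^{-k})$ and $Q(z)=q_0+\sum_{k=1}^m q_k(z^k+z^{-k})$ have real coefficients and be positive on the unit circle, and let $\tilde L(z)$ be the rational spectral factor of $P/Q$: a quotient of two real polynomials in $z^{-1}$ of degree at most $m$ without zeros in $|z|\ge1$ (including $z=\infty$), with $\tilde L(\infty)>0$ and $|\tilde L|^2=P/Q$ on $|z|=1$. Then the controller $$K(z)=K_{H_2}(z)+\Delta(z)^{-1}\big\{\{\Delta K_\circ\}_-\tilde L\big\}_+(z)\,\tilde L(z)^{-1}$$ exists, is uniquely determined on the unit circle, and is rational. It has the following state-space realization. The Riccati equation $X=C^*C+A^*XA-A^*XB_u(I+B_u^*XB_u)^{-1}B_u^*XA$ has a unique stabilizing symmetric solution $X$, and $X\succ0$. Put $S=I+B_u^*XB_u$, $K_{\rm lqr}=S^{-1}B_u^*XA$ and $A_k=A-B_uK_{\rm lqr}$. The factor $\tilde L$ has a realization $\tilde L(z)=(I+\tilde C(zI-\tilde A)^{-1}\tilde B)\tilde D^{1/2}$ of order $m$ with $\tilde D>0$ and $\tilde A$, $\tilde A_k:=\tilde A-\tilde B\tilde C$ having all eigenvalues in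 the open unit disc. For every such realization of $\tilde L$ (of any order), the equation $A_k^*XB_w\tilde C+A_k^*\tilde U\tilde A=\tilde U$ has a unique solution $\tilde U$. With $$\tilde F=\begin{bmatrix}\tilde A_k&0\\ B_uS^{-1}B_u^*\tilde U&A_k\end{bmatrix},\quad \tilde G=\begin{bmatrix}\tilde A_k\tilde B\\-B_w+B_uS^{-1}B_u^*(XB_w+\tilde U\tilde B)\end{bmatrix},$$ $$\tilde H=\begin{bmatrix}-S^{-1}B_u^*\tilde U&K_{\rm lqr}\end{bmatrix},\quad \tilde J=-S^{-1}B_u^*(XB_w+\tilde U\tilde B),$$ all eigenvalues of $\tilde F$ lie in the open unit disc and $K(z)=\tilde H(zI-\tilde F)^{-1}\tilde G+\tilde J$ on the unit circle. The controller is realized by $e_{t+1}=\tilde Fe_t+\tilde Gw_t$, $u_t=\tilde He_t+\tilde Jw_t$: for every bounded disturbance $(w_t)_{t\in\mathbb Z}$ there is exactly one bounded state trajectory $(e_t)_{t\in\mathbb Z}$, and its output is $u_t=\sum_{k\ge0}\hat K_kw_{t-k}$, where $K(z)=\sum_{k\ge0}\hat K_kz^{-k}$. -/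

import Mathlib

open scoped Matrix Polynomial

noncomputable section

namespace DRRO

/-! ### Matrices and linear systems -/

/-- A real matrix, seen as a complex matrix. -/
def cplx {ι κ : Type*} (M : Matrix ι κ ℝ) : Matrix ι κ ℂ :=
  M.map (fun x : ℝ => (x : ℂ))

/-- `(z I - A)⁻¹`. -/
def zResolvent {ι : Type*} [Fintype ι] [DecidableEq ι] (A : Matrix ι ι ℝ) (z : ℂ) :
    Matrix ι ι ℂ :=
  (z • (1 : Matrix ι ι ℂ) - cplx A)⁻¹

/-- All eigenvalues of the real matrix `A` lie in the open unit disc. -/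
def IsSchur {ι : Type*} [Fintype ι] [DecidableEq ι] (A : Matrix ι ι ℝ) : Prop :=
  ∀ μ ∈ spectrum ℂ (cplx A), ‖μ‖ < 1

/-- The pair `(A, B)` is stabilizable. -/
def IsStabilizable {dx du : ℕ} (A : Matrix (Fin dx) (Fin dx) ℝ)
    (B : Matrix (Fin dx) (Fin du) ℝ) : Prop :=
  ∃ K : Matrix (Fin du) (Fin dx) ℝ, IsSchur (A - B * K)

/-- The pair `(A, C)` is observable. -/
def IsObservable {dx ds : ℕ} (A : Matrix (Fin dx) (Fin dx) ℝ)
    (C : Matrix (Fin ds) (Fin dx) ℝ) : Prop :=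
  ∀ x : Fin dx → ℝ, (∀ k : ℕ, (C * A ^ k) *ᵥ x = 0) → x = 0

/-! ### Transfer functions on the unit circle

A transfer function is a matrix-valued function of `z : ℂ`; only its values on the unit circle
`‖z‖ = 1` matter. -/

/-- `X(z) = ∑_{k ≥ 0} X_k z^{-k}` on the unit circle, the series converging absolutely. -/
def HasMarkovParameters {ι κ : Type*} (X : ℂ → Matrix ι κ ℂ) (c : ℕ → Matrix ι κ ℂ) : Prop :=
  (∀ i j, Summable fun k => ‖c k i j‖) ∧
    ∀ z : ℂ, ‖z‖ = 1 → ∀ i j, HasSum (fun k => c k i j * (z⁻¹) ^ k) (X z i j)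

/-- `X` is the transfer function of a (stable) causal convolution operator. -/
def IsCausal {ι κ : Type*} (X : ℂ → Matrix ι κ ℂ) : Prop :=
  ∃ c : ℕ → Matrix ι κ ℂ, HasMarkovParameters X c

/-- `X` is the transfer function of a (stable) strictly anticausal convolution operator:
`X(z) = ∑_{k ≥ 1} X_{-k} z^k` on the unit circle, the series converging absolutely. -/
def IsStrictlyAnticausal {ι κ : Type*} (X : ℂ → Matrix ι κ ℂ) : Prop :=
  ∃ c : ℕ → Matrix ι κ ℂ, (∀ i j, Summable fun k => ‖c k i j‖) ∧
    ∀ z : ℂ, ‖z‖ = 1 → ∀ i j, HasSum (fun k => c k i j * z ^ (k + 1)) (X z i j)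

/-- `Xp` is the causal part `{X}₊` of `X`. -/
def IsCausalPart {ι κ : Type*} (X Xp : ℂ → Matrix ι κ ℂ) : Prop :=
  IsCausal Xp ∧ ∃ Xm : ℂ → Matrix ι κ ℂ, IsStrictlyAnticausal Xm ∧
    ∀ z : ℂ, ‖z‖ = 1 → X z = Xp z + Xm z

/-- On the unit circle `X` is a quotient of polynomials with real coefficients. -/
def IsRational {ι κ : Type*} (X : ℂ → Matrix ι κ ℂ) : Prop :=
  ∃ (N : Matrix ι κ ℝ[X]) (d : ℝ[X]), ∀ z : ℂ, ‖z‖ = 1 →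
    Polynomial.aeval z d ≠ 0 ∧
      ∀ i j, X z i j = Polynomial.aeval z (N i j) / Polynomial.aeval z d

section Plant

variable {dx du ds : ℕ}

/-- The points of the unit circle that are not eigenvalues of `A` (all but finitely many). -/
def IsRegularPoint (A : Matrix (Fin dx) (Fin dx) ℝ) (z : ℂ) : Prop :=
  ‖z‖ = 1 ∧ z ∉ spectrum ℂ (cplx A)

/-- The transfer function `C (z I - A)⁻¹ B`: `F(z)` for `B = B_u`, and `G(z)` for `B = B_w`. -/
def plantTF {d : ℕ} (A : Matrix (Fin dx) (Fin dx) ℝ) (C : Matrix (Fin ds) (Fin dx) ℝ)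
    (B : Matrix (Fin dx) (Fin d) ℝ) (z : ℂ) : Matrix (Fin ds) (Fin d) ℂ :=
  cplx C * zResolvent A z * cplx B

/-- The optimal noncausal policy `K_∘ = -(I + F* F)⁻¹ F* G`, at regular points of the circle. -/
def noncausalPolicy {dw : ℕ} (A : Matrix (Fin dx) (Fin dx) ℝ) (Bu : Matrix (Fin dx) (Fin du) ℝ)
    (Bw : Matrix (Fin dx) (Fin dw) ℝ) (C : Matrix (Fin ds) (Fin dx) ℝ) (z : ℂ) :
    Matrix (Fin du) (Fin dw) ℂ :=
  -((1 + (plantTF A C Bu z)ᴴ * plantTF A C Bu z)⁻¹ * (plantTF A C Bu z)ᴴ * plantTF A C Bw z)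

/-- `V` is a causal control law `u = V w` for which the state of
`x_{t+1} = A x_t + B_u u_t + B w_t` depends on `w` through a stable causal operator `X`. If all
eigenvalues of `A` are in the open unit disc, this just says that `V` is causal. -/
def IsStabilizingLaw {d : ℕ} (A : Matrix (Fin dx) (Fin dx) ℝ) (Bu : Matrix (Fin dx) (Fin du) ℝ)
    (B : Matrix (Fin dx) (Fin d) ℝ) (V : ℂ → Matrix (Fin du) (Fin d) ℂ) : Prop :=
  IsCausal V ∧ ∃ X : ℂ → Matrix (Fin dx) (Fin d) ℂ, IsCausal X ∧
    ∀ z : ℂ, ‖z‖ = 1 →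
      (z • (1 : Matrix (Fin dx) (Fin dx) ℂ) - cplx A) * X z = cplx Bu * V z + cplx B

/-- `Δ` is a canonical spectral factor of `I + F* F`: `Δ* Δ = I + F* F`, and `Δ`, `Δ⁻¹` are
causal. Causality is meant with respect to the plant, since `F` itself is not stable if `A` is not:
`Δ` sends those causal inputs that keep the state stable to causal signals, and
`Δ⁻¹` sends causal signals to such inputs. If all eigenvalues of `A` are in the open unit disc,
this says that `Δ` and `Δ⁻¹` are causal in the sense of `IsCausal`. -/
def IsCanonicalFactor (A : Matrix (Fin dx) (Fin dx) ℝ) (Bu : Matrix (Fin dx) (Fin du) ℝ)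
    (C : Matrix (Fin ds) (Fin dx) ℝ) (Δ : ℂ → Matrix (Fin du) (Fin du) ℂ) : Prop :=
  (∀ z : ℂ, IsRegularPoint A z →
      (Δ z)ᴴ * Δ z = 1 + (plantTF A C Bu z)ᴴ * plantTF A C Bu z) ∧
  (∀ (d : ℕ) (V : ℂ → Matrix (Fin du) (Fin d) ℂ), IsStabilizingLaw A Bu 0 V →
      ∃ Y : ℂ → Matrix (Fin du) (Fin d) ℂ, IsCausal Y ∧
        ∀ z : ℂ, IsRegularPoint A z → Δ z * V z = Y z) ∧
  ∃ V : ℂ → Matrix (Fin du) (Fin du) ℂ, IsStabilizingLaw A Bu 0 V ∧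
    ∀ z : ℂ, IsRegularPoint A z → Δ z * V z = 1

/-- `U = {Δ K_∘}₊` and `T = {Δ K_∘}₋`: `Δ K_∘ = U + T` with `T` strictly anticausal and `U` causal.
As for `Δ`, causality of `U` is meant with respect to the plant: `Δ⁻¹ U` (the `H₂` controller) is
a causal control law that keeps the state stable. If all eigenvalues of `A` are in the open unit
disc, this says that `U` is causal in the sense of `IsCausal`. -/
def IsPlantSplit {dw : ℕ} (A : Matrix (Fin dx) (Fin dx) ℝ) (Bu : Matrix (Fin dx) (Fin du) ℝ)
    (Bw : Matrix (Fin dx) (Fin dw) ℝ) (C : Matrix (Fin ds) (Fin dx) ℝ)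
    (Δ : ℂ → Matrix (Fin du) (Fin du) ℂ) (U T : ℂ → Matrix (Fin du) (Fin dw) ℂ) : Prop :=
  IsStrictlyAnticausal T ∧
  (∀ z : ℂ, IsRegularPoint A z → Δ z * noncausalPolicy A Bu Bw C z = U z + T z) ∧
  ∃ V : ℂ → Matrix (Fin du) (Fin dw) ℂ, IsStabilizingLaw A Bu Bw V ∧
    ∀ z : ℂ, IsRegularPoint A z → U z = Δ z * V z

/-- `K = K_{H₂} + Δ⁻¹ {{Δ K_∘}₋ L}₊ L⁻¹` with `K_{H₂} = Δ⁻¹ {Δ K_∘}₊`, a causal controller. Causality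
of `K` only matters to fix the values of `K` at eigenvalues of `A` on the unit circle. -/
def IsController (A : Matrix (Fin dx) (Fin dx) ℝ) (Bu : Matrix (Fin dx) (Fin du) ℝ)
    (Bw : Matrix (Fin dx) (Fin 1) ℝ) (C : Matrix (Fin ds) (Fin dx) ℝ) (L : ℂ → ℂ)
    (K : ℂ → Matrix (Fin du) (Fin 1) ℂ) : Prop :=
  IsCausal K ∧
  ∃ (Δ : ℂ → Matrix (Fin du) (Fin du) ℂ) (U T W : ℂ → Matrix (Fin du) (Fin 1) ℂ),
    IsCanonicalFactor A Bu C Δ ∧ IsPlantSplit A Bu Bw C Δ U T ∧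
    IsCausalPart (fun z => L z • T z) W ∧
    ∀ z : ℂ, IsRegularPoint A z → K z = (Δ z)⁻¹ * U z + (L z)⁻¹ • ((Δ z)⁻¹ * W z)

end Plant

/-! ### Rational spectra, their spectral factors, and realizations of these -/

/-- The symmetric trigonometric polynomial `p_0 + ∑_{k=1}^m p_k (z^k + z^{-k})`. -/
def trigPoly (m : ℕ) (p : ℕ → ℝ) (z : ℂ) : ℂ :=
  (p 0 : ℂ) + ∑ k ∈ Finset.Icc 1 m, (p k : ℂ) * (z ^ k + (z⁻¹) ^ k)

/-- The symmetric trigonometric polynomial is positive on the unit circle (where it is real). -/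
def IsPositiveTrigPoly (m : ℕ) (p : ℕ → ℝ) : Prop :=
  ∀ z : ℂ, ‖z‖ = 1 → 0 < (trigPoly m p z).re

/-- `L` is the rational spectral factor of the spectrum `P(z) / Q(z)` of degree `m`: a quotient of
two polynomials in `z⁻¹` of degree at most `m` which do not vanish for `|z| ≥ 1` (infinity
included), so that `L` and `L⁻¹` are causal, with `|L|² = P / Q` on the unit circle, and normalized
by `L(∞) > 0`. -/
def IsRationalSpectralFactor (m : ℕ) (p q : ℕ → ℝ) (L : ℂ → ℂ) : Prop :=
  ∃ a b : ℝ[X], a.natDegree ≤ m ∧ b.natDegree ≤ m ∧ 0 < a.coeff 0 ∧ 0 < b.coeff 0 ∧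
    (∀ ζ : ℂ, ‖ζ‖ ≤ 1 → Polynomial.aeval ζ a ≠ 0 ∧ Polynomial.aeval ζ b ≠ 0) ∧
    ∀ z : ℂ, ‖z‖ = 1 → L z = Polynomial.aeval z⁻¹ a / Polynomial.aeval z⁻¹ b ∧
      (starRingEnd ℂ) (L z) * L z = trigPoly m p z / trigPoly m q z

/-- `L(z) = (I + C̃ (z I - Ã)⁻¹ B̃) D̃^{1/2}`, a stable realization with stable inverse. -/
def IsFactorRealization {n : ℕ} (L : ℂ → ℂ) (At : Matrix (Fin n) (Fin n) ℝ)
    (Bt : Matrix (Fin n) (Fin 1) ℝ) (Ct : Matrix (Fin 1) (Fin n) ℝ) (Dt : ℝ) : Prop :=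
  IsSchur At ∧ IsSchur (At - Bt * Ct) ∧ 0 < Dt ∧
    ∀ z : ℂ, ‖z‖ = 1 →
      L z = (1 + (cplx Ct * zResolvent At z * cplx Bt) 0 0) * (Real.sqrt Dt : ℂ)

/-! ### The state-space controller -/

section Controller

variable {dx du ds : ℕ}

/-- `(I + B_u* P B_u)⁻¹`. -/
def gainInv (Bu : Matrix (Fin dx) (Fin du) ℝ) (P : Matrix (Fin dx) (Fin dx) ℝ) :
    Matrix (Fin du) (Fin du) ℝ :=
  (1 + Buᵀ * P * Bu)⁻¹

/-- `K_lqr = (I + B_u* P B_u)⁻¹ B_u* P A`. -/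
def lqrGain (A : Matrix (Fin dx) (Fin dx) ℝ) (Bu : Matrix (Fin dx) (Fin du) ℝ)
    (P : Matrix (Fin dx) (Fin dx) ℝ) : Matrix (Fin du) (Fin dx) ℝ :=
  gainInv Bu P * Buᵀ * P * A

/-- `A_k = A - B_u K_lqr`. -/
def closedLoop (A : Matrix (Fin dx) (Fin dx) ℝ) (Bu : Matrix (Fin dx) (Fin du) ℝ)
    (P : Matrix (Fin dx) (Fin dx) ℝ) : Matrix (Fin dx) (Fin dx) ℝ :=
  A - Bu * lqrGain A Bu P

/-- `P` is a stabilizing solution of the LQR Riccati equation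
`P = C* C + A* P A - A* P B_u (I + B_u* P B_u)⁻¹ B_u* P A`. -/
def IsStabilizingRiccati (A : Matrix (Fin dx) (Fin dx) ℝ) (Bu : Matrix (Fin dx) (Fin du) ℝ)
    (C : Matrix (Fin ds) (Fin dx) ℝ) (P : Matrix (Fin dx) (Fin dx) ℝ) : Prop :=
  P.IsSymm ∧ IsUnit (1 + Buᵀ * P * Bu).det ∧
    P = Cᵀ * C + Aᵀ * P * A - Aᵀ * P * Bu * gainInv Bu P * Buᵀ * P * A ∧
    IsSchur (closedLoop A Bu P)

variable {n : ℕ}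

/-- `Ũ` solves the Lyapunov (Stein) equation `A_k* P B_w C̃ + A_k* Ũ Ã = Ũ`. -/
def IsSteinSolution (A : Matrix (Fin dx) (Fin dx) ℝ) (Bu : Matrix (Fin dx) (Fin du) ℝ)
    (Bw : Matrix (Fin dx) (Fin 1) ℝ) (P : Matrix (Fin dx) (Fin dx) ℝ)
    (At : Matrix (Fin n) (Fin n) ℝ) (Ct : Matrix (Fin 1) (Fin n) ℝ)
    (Ut : Matrix (Fin dx) (Fin n) ℝ) : Prop :=
  (closedLoop A Bu P)ᵀ * P * Bw * Ct + (closedLoop A Bu P)ᵀ * Ut * At = Ut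

/-- The state matrix `F̃`. -/
def ctrlF (A : Matrix (Fin dx) (Fin dx) ℝ) (Bu : Matrix (Fin dx) (Fin du) ℝ)
    (P : Matrix (Fin dx) (Fin dx) ℝ) (At : Matrix (Fin n) (Fin n) ℝ)
    (Bt : Matrix (Fin n) (Fin 1) ℝ) (Ct : Matrix (Fin 1) (Fin n) ℝ)
    (Ut : Matrix (Fin dx) (Fin n) ℝ) : Matrix (Fin n ⊕ Fin dx) (Fin n ⊕ Fin dx) ℝ :=
  Matrix.fromBlocks (At - Bt * Ct) 0 (Bu * gainInv Bu P * Buᵀ * Ut) (closedLoop A Bu P)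

/-- The input matrix `G̃`. -/
def ctrlG (Bu : Matrix (Fin dx) (Fin du) ℝ) (Bw : Matrix (Fin dx) (Fin 1) ℝ)
    (P : Matrix (Fin dx) (Fin dx) ℝ) (At : Matrix (Fin n) (Fin n) ℝ)
    (Bt : Matrix (Fin n) (Fin 1) ℝ) (Ct : Matrix (Fin 1) (Fin n) ℝ)
    (Ut : Matrix (Fin dx) (Fin n) ℝ) : Matrix (Fin n ⊕ Fin dx) (Fin 1) ℝ :=
  Matrix.fromRows ((At - Bt * Ct) * Bt)
    (-Bw + Bu * gainInv Bu P * Buᵀ * (P * Bw + Ut * Bt))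

/-- The output matrix `H̃`. -/
def ctrlH (A : Matrix (Fin dx) (Fin dx) ℝ) (Bu : Matrix (Fin dx) (Fin du) ℝ)
    (P : Matrix (Fin dx) (Fin dx) ℝ) (Ut : Matrix (Fin dx) (Fin n) ℝ) :
    Matrix (Fin du) (Fin n ⊕ Fin dx) ℝ :=
  Matrix.fromCols (-(gainInv Bu P * Buᵀ * Ut)) (lqrGain A Bu P)

/-- The feedthrough matrix `J̃`. -/
def ctrlJ (Bu : Matrix (Fin dx) (Fin du) ℝ) (Bw : Matrix (Fin dx) (Fin 1) ℝ)
    (P : Matrix (Fin dx) (Fin dx) ℝ) (Bt : Matrix (Fin n) (Fin 1) ℝ)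
    (Ut : Matrix (Fin dx) (Fin n) ℝ) : Matrix (Fin du) (Fin 1) ℝ :=
  -(gainInv Bu P * Buᵀ * (P * Bw + Ut * Bt))

end Controller

/-- A sequence of vectors indexed by time is bounded. -/
def IsBoundedSignal {ι : Type*} (w : ℤ → ι → ℝ) : Prop :=
  ∃ c : ℝ, ∀ t i, |w t i| ≤ c

/-- `e` is a bounded trajectory of `e_{t+1} = F e_t + G w_t`, `t ∈ ℤ`. -/
def IsStateTrajectory {σ κ : Type*} [Fintype σ] [Fintype κ] (F : Matrix σ σ ℝ) (G : Matrix σ κ ℝ)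
    (w : ℤ → κ → ℝ) (e : ℤ → σ → ℝ) : Prop :=
  IsBoundedSignal e ∧ ∀ t : ℤ, e (t + 1) = F *ᵥ e t + G *ᵥ w t

/-- The controller `u_t = ∑_{s ≤ t} K_{t-s} w_s` is realized by the state-space model
`e_{t+1} = F e_t + G w_t`, `u_t = H e_t + J w_t`: each bounded disturbance drives exactly one bounded
state trajectory, and the output along it is `u`. -/
def IsRealizedBy {ι κ σ : Type*} [Fintype σ] [Fintype κ] (Kh : ℕ → Matrix ι κ ℝ)
    (F : Matrix σ σ ℝ) (G : Matrix σ κ ℝ) (H : Matrix ι σ ℝ) (J : Matrix ι κ ℝ) : Prop :=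
  ∀ w : ℤ → κ → ℝ, IsBoundedSignal w →
    (∃! e : ℤ → σ → ℝ, IsStateTrajectory F G w e) ∧
    ∀ e : ℤ → σ → ℝ, IsStateTrajectory F G w e →
      ∀ t : ℤ, HasSum (fun k : ℕ => Kh k *ᵥ w (t - k)) (H *ᵥ e t + J *ᵥ w t)

end DRRO

end

open DRRO

/-! Write `Φ = (zI - A)⁻¹`, `Φ_k = (zI - A_k)⁻¹`, `S = I + B_u* P B_u` and `S = Rᵀ R`, with `P` the
stabilizing Riccati solution. The Riccati equation factors the spectrum: `I + F*F = (I + K_lqr Φ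
B_u)* S (I + K_lqr Φ B_u)`, so `Δ = R (I + K_lqr Φ B_u)` is a canonical factor, with inverse `(I -
K_lqr Φ_k B_u) R⁻¹`. The same computation for `F*G` splits `Δ K_∘` explicitly: the causal part is
`Δ` times a static feedback law (`h2Law`), and the strictly anticausal part involves only the
reflected resolvent `(z⁻¹I - A_kᵀ)⁻¹`.

Multiplying the latter by `L` produces products `(z⁻¹I - A_kᵀ)⁻¹ Q (zI - Ã)⁻¹`. The Stein equation
is the condition that splits such a product into an anticausal and a causal summand. Division by `L`
then replaces the resolvent of `Ã` by that of `Ã - B̃ C̃`, and block elimination shows that the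
result is the transfer function of the stated realization.

Uniqueness rests on the fact that a causal series equal to a strictly anticausal one vanishes. It
shows that two canonical factors differ by a constant left factor `M`, and that the causal parts
belonging to them differ by the same `M`, which cancels in `K`. Identities are first proved away
from the eigenvalues of `A` and reach the whole circle by continuity.

The Riccati solution is the limit of value iteration started at `0`, bounded by the cost of a
stabilizing feedback; observability makes it positive definite and stabilizing. The main steps are
`exists_posDef_isStabilizingRiccati`, `IsController.unique`, `riccatiFactor_mul_noncausalPolicy`,
`zResolvent_inv_mul_mul_zResolvent` and `ctrl_transfer_eq`. -/

/-! ### Real matrices seen as complex matrices -/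

section Cplx

variable {ι κ l : Type*}

@[simp] theorem cplx_apply (M : Matrix ι κ ℝ) (i : ι) (j : κ) : cplx M i j = (M i j : ℂ) := rfl

theorem cplx_mul [Fintype κ] (M : Matrix ι κ ℝ) (N : Matrix κ l ℝ) :
    cplx (M * N) = cplx M * cplx N :=
  Matrix.map_mul (f := Complex.ofRealHom)

theorem cplx_add (M N : Matrix ι κ ℝ) : cplx (M + N) = cplx M + cplx N := by
  ext; simp

theorem cplx_sub (M N : Matrix ι κ ℝ) : cplx (M - N) = cplx M - cplx N := by
  ext; simp

theorem cplx_neg (M : Matrix ι κ ℝ) : cplx (-M) = -cplx M := by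
  ext; simp

@[simp] theorem cplx_zero : cplx (0 : Matrix ι κ ℝ) = 0 := by
  ext; simp

@[simp] theorem cplx_one [DecidableEq ι] : cplx (1 : Matrix ι ι ℝ) = 1 := by
  ext i j; by_cases h : i = j <;> simp [h, Matrix.one_apply]

theorem cplx_pow [Fintype ι] [DecidableEq ι] (M : Matrix ι ι ℝ) (k : ℕ) :
    cplx (M ^ k) = cplx M ^ k := by
  induction k with
  | zero => simp
  | succ k ih => rw [pow_succ, pow_succ, cplx_mul, ih]

theorem cplx_transpose (M : Matrix ι κ ℝ) : cplx Mᵀ = (cplx M)ᵀ := rfl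

@[simp] theorem cplx_conjTranspose (M : Matrix ι κ ℝ) : (cplx M)ᴴ = cplx Mᵀ := by
  ext; simp

theorem cplx_fromBlocks {n o : Type*} (M : Matrix ι κ ℝ) (N : Matrix ι o ℝ) (P : Matrix n κ ℝ)
    (Q : Matrix n o ℝ) : cplx (Matrix.fromBlocks M N P Q) =
      Matrix.fromBlocks (cplx M) (cplx N) (cplx P) (cplx Q) :=
  Matrix.fromBlocks_map _ _ _ _ _

end Cplx

/-! ### Schur matrices and their resolvents -/

/-- Gelfand's formula: `‖a ^ k‖ ^ (1/k)` tends to the spectral radius. The latter is below some `r <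
1`, so `‖a ^ k‖ ≤ r ^ k` eventually. -/
theorem summable_norm_pow_of_spectrum {R : Type*} [NormedRing R] [NormedAlgebra ℂ R]
    [CompleteSpace R] (a : R) (ha : ∀ μ ∈ spectrum ℂ a, ‖μ‖ < 1) :
    Summable fun k : ℕ => ‖a ^ k‖ := by
  cases subsingleton_or_nontrivial R
  · have : (fun k : ℕ => ‖a ^ k‖) = fun _ => 0 := by
      ext k; rw [Subsingleton.elim (a ^ k) 0, norm_zero]
    rw [this]; exact summable_zero
  have hlt : spectralRadius ℂ a < (1 : NNReal) :=
    spectrum.spectralRadius_lt_of_forall_lt a fun μ hμ => by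
      rw [← NNReal.coe_lt_coe]; simpa using ha μ hμ
  obtain ⟨r, hr1, hr2⟩ := ENNReal.lt_iff_exists_nnreal_btwn.1 hlt
  have hev := (spectrum.pow_nnnorm_pow_one_div_tendsto_nhds_spectralRadius a).eventually_lt_const
    hr1
  refine Summable.of_norm_bounded_eventually_nat (g := fun k => (r : ℝ) ^ k)
    (summable_geometric_of_lt_one r.2 (by exact_mod_cast hr2)) ?_
  filter_upwards [hev, Filter.eventually_gt_atTop 0] with k hk hk0
  have hk' : (‖a ^ k‖₊ : ENNReal) ≤ (r : ENNReal) ^ k := by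
    have := ENNReal.rpow_le_rpow hk.le (z := (k : ℝ)) (by positivity)
    rwa [← ENNReal.rpow_mul, one_div, inv_mul_cancel₀ (by positivity), ENNReal.rpow_one,
      ENNReal.rpow_natCast] at this
  rw [norm_norm]
  exact_mod_cast hk'

section Schur

variable {ι : Type*} [Fintype ι] [DecidableEq ι] {A : Matrix ι ι ℝ}

theorem DRRO.IsSchur.summable_pow (hA : IsSchur A) (i j : ι) :
    Summable fun k : ℕ => ‖(cplx A ^ k) i j‖ := by
  -- The maximal row sum norm makes matrices a Banach algebra and dominates each entry.
  let _ := Matrix.linftyOpNormedRing (n := ι) (α := ℂ)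
  let _ := Matrix.linftyOpNormedAlgebra (n := ι) (R := ℂ) (α := ℂ)
  refine (summable_norm_pow_of_spectrum (cplx A) hA).of_nonneg_of_le (fun _ => norm_nonneg _)
    fun k => ?_
  rw [Matrix.linfty_opNorm_def, ← coe_nnnorm, NNReal.coe_le_coe]
  exact (Finset.single_le_sum (f := fun j => ‖(cplx A ^ k) i j‖₊) (fun _ _ => zero_le)
    (Finset.mem_univ j)).trans (Finset.le_sup (f := fun i => ∑ j, ‖(cplx A ^ k) i j‖₊)
      (Finset.mem_univ i))

theorem DRRO.IsSchur.summable_pow_real (hA : IsSchur A) (i j : ι) :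
    Summable fun k : ℕ => |(A ^ k) i j| := by
  simpa [← cplx_pow] using hA.summable_pow i j

theorem isUnit_sub_of_notMem_spectrum {z : ℂ} (hz : z ∉ spectrum ℂ (cplx A)) :
    IsUnit (z • (1 : Matrix ι ι ℂ) - cplx A) := by
  rw [spectrum.notMem_iff, Algebra.algebraMap_eq_smul_one] at hz
  exact hz

theorem sub_mul_zResolvent {z : ℂ} (hz : z ∉ spectrum ℂ (cplx A)) :
    (z • (1 : Matrix ι ι ℂ) - cplx A) * zResolvent A z = 1 :=
  Matrix.mul_nonsing_inv _ ((Matrix.isUnit_iff_isUnit_det _).1 (isUnit_sub_of_notMem_spectrum hz))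

theorem zResolvent_mul_sub {z : ℂ} (hz : z ∉ spectrum ℂ (cplx A)) :
    zResolvent A z * (z • (1 : Matrix ι ι ℂ) - cplx A) = 1 :=
  Matrix.nonsing_inv_mul _ ((Matrix.isUnit_iff_isUnit_det _).1 (isUnit_sub_of_notMem_spectrum hz))

theorem smul_zResolvent {z : ℂ} (hz : z ∉ spectrum ℂ (cplx A)) :
    z • zResolvent A z = 1 + cplx A * zResolvent A z := by
  have := sub_mul_zResolvent hz
  rw [Matrix.sub_mul, Matrix.smul_mul, Matrix.one_mul] at this
  rw [← this]; abel

theorem smul_zResolvent' {z : ℂ} (hz : z ∉ spectrum ℂ (cplx A)) :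
    z • zResolvent A z = 1 + zResolvent A z * cplx A := by
  have := zResolvent_mul_sub hz
  rw [Matrix.mul_sub, Matrix.mul_smul, Matrix.mul_one] at this
  rw [← this]; abel

theorem DRRO.IsSchur.notMem (hA : IsSchur A) {z : ℂ} (hz : ‖z‖ = 1) :
    z ∉ spectrum ℂ (cplx A) := fun h => by
  have := hA z h
  rw [hz] at this
  exact lt_irrefl _ this

theorem isSchur_iff_charpoly : IsSchur A ↔ ∀ μ : ℂ, (cplx A).charpoly.IsRoot μ → ‖μ‖ < 1 := by
  simp only [IsSchur, Matrix.mem_spectrum_iff_isRoot_charpoly]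

theorem DRRO.IsSchur.transpose (hA : IsSchur A) : IsSchur Aᵀ := by
  rw [isSchur_iff_charpoly, cplx_transpose, Matrix.charpoly_transpose]
  exact isSchur_iff_charpoly.1 hA

theorem isSchur_of_eigenvector (h : ∀ (μ : ℂ) (v : ι → ℂ), v ≠ 0 → cplx A *ᵥ v = μ • v → ‖μ‖ < 1) :
    IsSchur A := by
  intro μ hμ
  rw [← Matrix.spectrum_toLin', ← Module.End.hasEigenvalue_iff_mem_spectrum] at hμ
  obtain ⟨v, hv⟩ := hμ.exists_hasEigenvector
  exact h μ v hv.2 (by simpa using hv.apply_eq_smul)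

theorem DRRO.IsSchur.fromBlocks {κ : Type*} [Fintype κ] [DecidableEq κ] {D : Matrix κ κ ℝ}
    (hA : IsSchur A) (hD : IsSchur D) (B : Matrix κ ι ℝ) :
    IsSchur (Matrix.fromBlocks A 0 B D) := by
  rw [isSchur_iff_charpoly] at *
  intro μ hμ
  rw [cplx_fromBlocks, cplx_zero, Matrix.charpoly_fromBlocks_zero₁₂, Polynomial.root_mul] at hμ
  exact hμ.elim (hA μ) (hD μ)

/-- Neumann series: applying `zI - A` makes the series telescope to `1`, so its sum is a right
inverse, hence the inverse. The exponent starts at `1`, so the resolvent is strictly causal. -/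
theorem DRRO.IsSchur.hasSum_zResolvent (hA : IsSchur A) {z : ℂ} (hz : ‖z‖ = 1) (i j : ι) :
    HasSum (fun k => (cplx A ^ k) i j * z⁻¹ ^ (k + 1)) (zResolvent A z i j) := by
  have hz0 : z ≠ 0 := by rintro rfl; simp at hz
  have hsum : ∀ i j, Summable fun k => (cplx A ^ k) i j * z⁻¹ ^ (k + 1) := fun i j => by
    refine Summable.of_norm ?_
    simpa [hz] using hA.summable_pow i j
  let X : Matrix ι ι ℂ := fun i j => ∑' k, (cplx A ^ k) i j * z⁻¹ ^ (k + 1)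
  have hX : (z • (1 : Matrix ι ι ℂ) - cplx A) * X = 1 := by
    ext i j
    have h1 : HasSum (fun k => ((z • (1 : Matrix ι ι ℂ) - cplx A) * cplx A ^ k) i j *
        z⁻¹ ^ (k + 1)) (((z • (1 : Matrix ι ι ℂ) - cplx A) * X) i j) := by
      simp only [Matrix.mul_apply, Finset.sum_mul, mul_assoc]
      exact hasSum_sum fun l _ => (hsum l j).hasSum.mul_left _
    have h2 : Summable fun k => (cplx A ^ k) i j * z⁻¹ ^ k :=
      Summable.of_norm (by simpa [hz] using hA.summable_pow i j)
    have h3 := h2.hasSum.sub ((hasSum_nat_add_iff' 1).2 h2.hasSum)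
    simp only [Finset.sum_range_one, pow_zero, sub_sub_cancel, mul_one] at h3
    have h4 : (fun k => ((z • (1 : Matrix ι ι ℂ) - cplx A) * cplx A ^ k) i j * z⁻¹ ^ (k + 1)) =
        fun k => (cplx A ^ k) i j * z⁻¹ ^ k - (cplx A ^ (k + 1)) i j * z⁻¹ ^ (k + 1) := by
      ext k
      rw [Matrix.sub_mul, Matrix.smul_mul, Matrix.one_mul, ← pow_succ', Matrix.sub_apply,
        Matrix.smul_apply, smul_eq_mul, sub_mul, pow_succ z⁻¹ k]
      field_simp
    rw [h4] at h1
    exact h1.unique h3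
  have : zResolvent A z = X := by
    calc zResolvent A z = zResolvent A z * ((z • (1 : Matrix ι ι ℂ) - cplx A) * X) := by
          rw [hX, Matrix.mul_one]
      _ = X := by rw [← Matrix.mul_assoc, zResolvent_mul_sub (hA.notMem hz), Matrix.one_mul]
  rw [this]
  exact (hsum i j).hasSum

end Schur

/-! ### Absolutely convergent one-sided series on the unit circle -/

/-- On the unit circle the entries of `X` are absolutely convergent series `∑ c k * φ k z`. -/
def IsAbsSeries {ι κ : Type*} (φ : ℕ → ℂ → ℂ) (X : ℂ → Matrix ι κ ℂ) : Prop :=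
  ∀ i j, ∃ c : ℕ → ℂ, (Summable fun k => ‖c k‖) ∧
    ∀ z : ℂ, ‖z‖ = 1 → HasSum (fun k => c k * φ k z) (X z i j)

/-- The basis functions `z⁻ᵏ` of causal transfer functions. -/
noncomputable def causalBasis (k : ℕ) (z : ℂ) : ℂ := z⁻¹ ^ k

/-- The basis functions `zᵏ⁺¹` of strictly anticausal transfer functions. -/
def anticausalBasis (k : ℕ) (z : ℂ) : ℂ := z ^ (k + 1)

/-- Choosing coefficients entry by entry gives causal and anticausal functions one common set of
closure properties, with only the basis `φ` changing. -/
theorem isCausal_iff {ι κ : Type*} {X : ℂ → Matrix ι κ ℂ} :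
    IsCausal X ↔ IsAbsSeries causalBasis X := by
  constructor
  · rintro ⟨c, hc, h⟩ i j
    exact ⟨fun k => c k i j, hc i j, fun z hz => h z hz i j⟩
  · intro h
    choose c hc h using h
    exact ⟨fun k i j => c i j k, hc, fun z hz i j => h i j z hz⟩

theorem isStrictlyAnticausal_iff {ι κ : Type*} {X : ℂ → Matrix ι κ ℂ} :
    IsStrictlyAnticausal X ↔ IsAbsSeries anticausalBasis X := by
  constructor
  · rintro ⟨c, hc, h⟩ i j
    exact ⟨fun k => c k i j, hc i j, fun z hz => h z hz i j⟩
  · intro h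
    choose c hc h using h
    exact ⟨fun k i j => c i j k, hc, fun z hz i j => h i j z hz⟩

namespace IsAbsSeries

variable {ι κ l : Type*} {φ : ℕ → ℂ → ℂ} {X Y : ℂ → Matrix ι κ ℂ}

theorem congr (hX : IsAbsSeries φ X) (h : ∀ z : ℂ, ‖z‖ = 1 → Y z = X z) : IsAbsSeries φ Y := by
  intro i j
  obtain ⟨c, hc, hs⟩ := hX i j
  exact ⟨c, hc, fun z hz => by rw [h z hz]; exact hs z hz⟩

theorem add (hX : IsAbsSeries φ X) (hY : IsAbsSeries φ Y) : IsAbsSeries φ fun z => X z + Y z := by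
  intro i j
  obtain ⟨c, hc, hs⟩ := hX i j
  obtain ⟨d, hd, ht⟩ := hY i j
  refine ⟨fun k => c k + d k, (hc.add hd).of_nonneg_of_le (fun _ => norm_nonneg _)
    fun k => norm_add_le _ _, fun z hz => ?_⟩
  simpa only [add_mul, Matrix.add_apply] using (hs z hz).add (ht z hz)

theorem mul_left [Fintype ι] (hX : IsAbsSeries φ X) (M : Matrix l ι ℂ) :
    IsAbsSeries φ fun z => M * X z := by
  intro i j
  choose c hc hs using hX
  refine ⟨fun k => ∑ a, M i a * c a j k, ?_, fun z hz => ?_⟩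
  · refine (summable_sum (s := Finset.univ) fun a _ => (hc a j).mul_left ‖M i a‖).of_nonneg_of_le
      (fun _ => norm_nonneg _) fun k => ?_
    exact (norm_sum_le _ _).trans_eq (by simp only [norm_mul])
  · simp only [Matrix.mul_apply, Finset.sum_mul, mul_assoc]
    exact hasSum_sum fun a _ => (hs a j z hz).mul_left _

theorem transpose (hX : IsAbsSeries φ X) : IsAbsSeries φ fun z => (X z)ᵀ :=
  fun i j => hX j i

theorem mul_right [Fintype κ] (hX : IsAbsSeries φ X) (M : Matrix κ l ℂ) :
    IsAbsSeries φ fun z => X z * M := by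
  have := (hX.transpose.mul_left Mᵀ).transpose
  simpa only [← Matrix.transpose_mul, Matrix.transpose_transpose] using this

theorem smul (hX : IsAbsSeries φ X) (a : ℂ) : IsAbsSeries φ fun z => a • X z := by
  intro i j
  obtain ⟨c, hc, hs⟩ := hX i j
  refine ⟨fun k => a * c k, by simpa only [norm_mul] using hc.mul_left ‖a‖, fun z hz => ?_⟩
  simpa only [mul_assoc, Matrix.smul_apply, smul_eq_mul] using (hs z hz).mul_left a

theorem neg (hX : IsAbsSeries φ X) : IsAbsSeries φ fun z => -X z := by
  simpa only [neg_one_smul] using hX.smul (-1)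

theorem sub (hX : IsAbsSeries φ X) (hY : IsAbsSeries φ Y) : IsAbsSeries φ fun z => X z - Y z := by
  simpa only [sub_eq_add_neg] using hX.add hY.neg

/-- Weierstrass M-test. Continuity is what later determines transfer functions at eigenvalues of `A`
on the circle. -/
theorem continuousOn (hX : IsAbsSeries φ X) (hφ : ∀ k, ContinuousOn (φ k) (Metric.sphere 0 1))
    (hφ' : ∀ k z, ‖z‖ = 1 → ‖φ k z‖ ≤ 1) (i : ι) (j : κ) :
    ContinuousOn (fun z => X z i j) (Metric.sphere 0 1) := by
  obtain ⟨c, hc, hs⟩ := hX i j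
  have : ContinuousOn (fun z => ∑' k, c k * φ k z) (Metric.sphere 0 1) := by
    refine continuousOn_tsum (fun k => continuousOn_const.mul (hφ k)) hc fun k z hz => ?_
    rw [norm_mul]
    exact mul_le_of_le_one_right (norm_nonneg _) (hφ' k z (by simpa using hz))
  exact this.congr fun z hz => (hs z (by simpa using hz)).tsum_eq.symm

theorem continuousOn_causal (hX : IsAbsSeries causalBasis X) (i : ι) (j : κ) :
    ContinuousOn (fun z => X z i j) (Metric.sphere 0 1) := by
  refine hX.continuousOn (fun k => ?_) (fun k z hz => by simp [causalBasis, hz]) i j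
  exact (continuousOn_inv₀.mono fun z hz => by
    rintro rfl
    simp at hz).pow k

theorem continuousOn_anticausal (hX : IsAbsSeries anticausalBasis X) (i : ι) (j : κ) :
    ContinuousOn (fun z => X z i j) (Metric.sphere 0 1) :=
  hX.continuousOn (fun k => (continuous_pow (k + 1)).continuousOn)
    (fun k z hz => by simp [anticausalBasis, hz]) i j

end IsAbsSeries

theorem isAbsSeries_const {ι κ : Type*} (M : Matrix ι κ ℂ) :
    IsAbsSeries causalBasis fun _ => M := by
  intro i j
  refine ⟨fun k => if k = 0 then M i j else 0, ?_, fun z _ => ?_⟩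
  · exact summable_of_ne_finset_zero (s := {0}) fun k hk => by simp_all
  · convert hasSum_ite_eq (0 : ℕ) (M i j) using 2 with k
    by_cases hk : k = 0 <;> simp [hk, causalBasis]

section Resolvent

variable {ι : Type*} [Fintype ι] [DecidableEq ι] {A : Matrix ι ι ℝ}

theorem DRRO.IsSchur.isAbsSeries_smul_zResolvent (hA : IsSchur A) :
    IsAbsSeries causalBasis fun z => z • zResolvent A z := by
  intro i j
  refine ⟨fun k => (cplx A ^ k) i j, hA.summable_pow i j, fun z hz => ?_⟩
  have hz0 : z ≠ 0 := by rintro rfl; simp at hz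
  have := (hA.hasSum_zResolvent hz i j).mul_left z
  have e : ∀ k, z * ((cplx A ^ k) i j * z⁻¹ ^ (k + 1)) = (cplx A ^ k) i j * causalBasis k z := by
    intro k
    rw [causalBasis, pow_succ]
    field_simp
  simp only [e] at this
  exact this

theorem DRRO.IsSchur.isAbsSeries_zResolvent (hA : IsSchur A) :
    IsAbsSeries causalBasis (zResolvent A) := by
  intro i j
  refine ⟨fun k => if k = 0 then 0 else (cplx A ^ (k - 1)) i j, ?_, fun z hz => ?_⟩
  · rw [← summable_nat_add_iff 1]
    simpa using hA.summable_pow i j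
  · rw [← hasSum_nat_add_iff' 1]
    simpa [causalBasis] using hA.hasSum_zResolvent hz i j

/-- Reflecting `z` to `z⁻¹` turns strictly causal into strictly anticausal. -/
theorem DRRO.IsSchur.isAbsSeries_zResolvent_inv (hA : IsSchur A) :
    IsAbsSeries anticausalBasis fun z => zResolvent A z⁻¹ := by
  intro i j
  refine ⟨fun k => (cplx A ^ k) i j, hA.summable_pow i j, fun z hz => ?_⟩
  simpa [anticausalBasis] using hA.hasSum_zResolvent (z := z⁻¹) (by simp [hz]) i j

end Resolvent

/-! ### Uniqueness of Laurent coefficients, and density of regular points -/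

/-- Absolute summability makes the Fourier series converge uniformly, hence in `L²`; pairing its
zero sum with the `n`-th orthonormal exponential leaves `a n`. -/
theorem laurent_coeff_eq_zero {a : ℤ → ℂ} (ha : Summable fun n => ‖a n‖)
    (h : ∀ z : ℂ, ‖z‖ = 1 → HasSum (fun n => a n * z ^ n) 0) : a = 0 := by
  ext n
  have : Fact (0 < 2 * Real.pi) := ⟨by positivity⟩
  let f (k : ℤ) : C(AddCircle (2 * Real.pi), ℂ) := (a k) • fourier (T := 2 * Real.pi) k
  have hsum : HasSum f 0 := by
    have hs : Summable f := Summable.of_norm (by simpa [f, norm_smul, fourier_norm] using ha)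
    convert hs.hasSum
    ext x
    rw [← ContinuousMap.tsum_apply hs]
    refine (HasSum.tsum_eq ?_).symm
    have := h (AddCircle.toCircle x) (Circle.norm_coe _)
    simpa [f, fourier_apply, AddCircle.toCircle_zsmul] using this
  have h1 := (hsum.mapL (ContinuousMap.toLp (E := ℂ) 2 AddCircle.haarAddCircle ℂ)).mapL
    (innerSL ℂ (fourierLp (T := 2 * Real.pi) 2 n))
  have h2 : ∀ k, innerSL ℂ (fourierLp (T := 2 * Real.pi) 2 n)
      (ContinuousMap.toLp (E := ℂ) 2 AddCircle.haarAddCircle ℂ (f k)) =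
        if k = n then a n else 0 := fun k => by
    have := orthonormal_iff_ite.1 (orthonormal_fourier (T := 2 * Real.pi)) n k
    simp only [f, map_smul, smul_eq_mul, innerSL_apply_apply]
    rw [← fourierLp, this]
    by_cases hk : k = n
    · simp [hk]
    · simp [hk, Ne.symm hk]
  simp only [h2, map_zero] at h1
  exact (hasSum_ite_eq n (a n)).unique h1

/-- The circle is connected with more than one point, so it has no isolated points and the
complement of a finite set is dense. -/
theorem eq_of_eq_off_finite {f g : ℂ → ℂ} (hf : ContinuousOn f (Metric.sphere 0 1))
    (hg : ContinuousOn g (Metric.sphere 0 1)) {s : Set ℂ} (hs : s.Finite)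
    (h : ∀ z : ℂ, ‖z‖ = 1 → z ∉ s → f z = g z) {z : ℂ} (hz : ‖z‖ = 1) : f z = g z := by
  have : ConnectedSpace (Metric.sphere (0 : ℂ) 1) :=
    Subtype.connectedSpace (isConnected_sphere (by simp) 0 zero_le_one)
  have : Nontrivial (Metric.sphere (0 : ℂ) 1) :=
    ⟨⟨1, by simp⟩, ⟨-1, by simp⟩, by
      intro h
      have := congrArg (fun z : Metric.sphere (0 : ℂ) 1 => (z : ℂ).re) h
      norm_num at this⟩
  have hd : Dense ((Subtype.val ⁻¹' s : Set (Metric.sphere (0 : ℂ) 1))ᶜ) := by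
    have := dense_univ.sdiff_finite (hs.preimage (f := (Subtype.val : Metric.sphere (0 : ℂ) 1 → ℂ)) Subtype.val_injective.injOn)
    rwa [← Set.compl_eq_univ_sdiff] at this
  have := Continuous.ext_on hd hf.domRestrict hg.domRestrict fun x hx => h x (by simp) hx
  exact congrFun this ⟨z, by simpa using hz⟩

section Uniqueness

variable {ι κ : Type*}

theorem eq_zero_of_causal_of_anticausal {X Y : ℂ → Matrix ι κ ℂ} (hX : IsAbsSeries causalBasis X)
    (hY : IsAbsSeries anticausalBasis Y) (h : ∀ z : ℂ, ‖z‖ = 1 → X z = Y z) {z : ℂ}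
    (hz : ‖z‖ = 1) : X z = 0 := by
  ext i j
  obtain ⟨c, hc, hs⟩ := hX i j
  obtain ⟨d, hd, ht⟩ := hY i j
  -- The Laurent coefficients of `X - Y` in the variable `w = z⁻¹`: those of `X` at `n ≥ 0`, the
  -- negated ones of `Y` at `n < 0`.
  obtain ⟨a, ha1, ha2⟩ : ∃ a : ℤ → ℂ, (∀ n : ℕ, a n = c n) ∧ ∀ n : ℕ, a (-(n + 1)) = -d n :=
    ⟨Int.rec c fun n => -d n, fun _ => rfl, fun n => by rw [← Int.negSucc_eq]⟩
  have ha : a = 0 := by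
    refine laurent_coeff_eq_zero (Summable.of_nat_of_neg_add_one (by simpa [ha1] using hc)
      (by simp only [ha2, norm_neg]; exact hd)) fun w hw => ?_
    have hw' : ‖w⁻¹‖ = 1 := by simp [hw]
    have h1 : HasSum (fun n : ℕ => a n * w ^ (n : ℤ)) (X w⁻¹ i j) := by
      simpa [ha1, causalBasis] using hs w⁻¹ hw'
    have h2 : HasSum (fun n : ℕ => a (-(n + 1)) * w ^ (-(n + 1) : ℤ)) (-Y w⁻¹ i j) := by
      have e : ∀ n : ℕ, a (-(n + 1)) * w ^ (-(n + 1) : ℤ) = -(d n * anticausalBasis n w⁻¹) := by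
        intro n
        rw [ha2, ← Int.negSucc_eq, zpow_negSucc]
        simp [anticausalBasis]
      simp only [e]
      exact (ht w⁻¹ hw').neg
    have h3 := HasSum.of_nat_of_neg_add_one (f := fun n => a n * w ^ n) h1 h2
    rwa [h _ hw', add_neg_cancel] at h3
  have hc0 : ∀ k, c k = 0 := fun k => by rw [← ha1, ha]; rfl
  have h4 := hs z hz
  simp only [hc0, zero_mul] at h4
  exact h4.unique hasSum_zero

theorem eq_of_causal_of_causal {X Y : ℂ → Matrix ι κ ℂ} (hX : IsAbsSeries causalBasis X)
    (hY : IsAbsSeries causalBasis Y) {s : Set ℂ} (hs : s.Finite)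
    (h : ∀ z : ℂ, ‖z‖ = 1 → z ∉ s → X z = Y z) {z : ℂ} (hz : ‖z‖ = 1) : X z = Y z := by
  ext i j
  exact eq_of_eq_off_finite (hX.continuousOn_causal i j) (hY.continuousOn_causal i j) hs
    (fun w hw hws => by rw [h w hw hws]) hz

theorem eq_zero_of_causal_of_anticausal_off_finite {X Y : ℂ → Matrix ι κ ℂ}
    (hX : IsAbsSeries causalBasis X) (hY : IsAbsSeries anticausalBasis Y) {s : Set ℂ}
    (hs : s.Finite) (h : ∀ z : ℂ, ‖z‖ = 1 → z ∉ s → X z = Y z) {z : ℂ} (hz : ‖z‖ = 1) :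
    X z = 0 ∧ Y z = 0 := by
  have hXY : ∀ z : ℂ, ‖z‖ = 1 → X z = Y z := fun w hw => by
    ext i j
    exact eq_of_eq_off_finite (hX.continuousOn_causal i j) (hY.continuousOn_anticausal i j) hs
      (fun w hw hws => by rw [h w hw hws]) hw
  have h0 := eq_zero_of_causal_of_anticausal hX hY hXY hz
  exact ⟨h0, by rw [← hXY z hz, h0]⟩

/-- A causal transfer function whose adjoint is causal as well is constant. -/
theorem eq_const_of_causal_of_causal_conjTranspose {X : ℂ → Matrix ι κ ℂ}
    {Y : ℂ → Matrix κ ι ℂ} (hX : IsAbsSeries causalBasis X) (hY : IsAbsSeries causalBasis Y)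
    {s : Set ℂ} (hs : s.Finite) (h : ∀ z : ℂ, ‖z‖ = 1 → z ∉ s → Y z = (X z)ᴴ) :
    ∃ M : Matrix ι κ ℂ, ∀ z : ℂ, ‖z‖ = 1 → X z = M := by
  choose c hc ht using hX
  -- The adjoint turns `z⁻ᵏ` into `zᵏ`; it becomes strictly anticausal once the constant term is
  -- removed.
  have hX' : IsAbsSeries anticausalBasis fun z => (X z)ᴴ - (Matrix.of fun i j => c i j 0)ᴴ := by
    intro i j
    refine ⟨fun k => star (c j i (k + 1)), ?_, fun z hz => ?_⟩
    · simpa using (summable_nat_add_iff 1).2 (hc j i)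
    · have hzz : star z = z⁻¹ := by
        rw [Complex.inv_eq_conj hz]; rfl
      have h1 := ((hasSum_nat_add_iff' 1).2 (ht j i z hz)).star
      simpa [causalBasis, anticausalBasis, ← hzz] using h1
  refine ⟨Matrix.of fun i j => c i j 0, fun z hz => ?_⟩
  have := (eq_zero_of_causal_of_anticausal_off_finite (hY.sub (isAbsSeries_const _)) hX' hs
    (fun w hw hws => by rw [h w hw hws]) hz).2
  rw [← Matrix.conjTranspose_sub, Matrix.conjTranspose_eq_zero, sub_eq_zero] at this
  exact this

end Uniqueness

/-! ### Stein equations -/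

open Filter Topology in
theorem DRRO.IsSchur.tendsto_pow {ι : Type*} [Fintype ι] [DecidableEq ι] {A : Matrix ι ι ℝ}
    (hA : IsSchur A) : Tendsto (fun k : ℕ => A ^ k) atTop (𝓝 0) := by
  refine tendsto_pi_nhds.2 fun i => tendsto_pi_nhds.2 fun j => ?_
  exact (hA.summable_pow_real i j).of_abs.tendsto_atTop_zero

section Tendsto

open Filter Topology

variable {α ι κ l : Type*} {f : Filter α} [Fintype κ]

theorem Filter.Tendsto.matrix_mul' {M : α → Matrix ι κ ℝ} {N : α → Matrix κ l ℝ}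
    {M₀ : Matrix ι κ ℝ} {N₀ : Matrix κ l ℝ} (hM : Tendsto M f (𝓝 M₀)) (hN : Tendsto N f (𝓝 N₀)) :
    Tendsto (fun a => M a * N a) f (𝓝 (M₀ * N₀)) :=
  ((continuous_fst.matrix_mul continuous_snd).tendsto (M₀, N₀)).comp (hM.prodMk_nhds hN)

theorem Filter.Tendsto.matrix_mulVec' {M : α → Matrix ι κ ℝ} {v : α → κ → ℝ}
    {M₀ : Matrix ι κ ℝ} {v₀ : κ → ℝ} (hM : Tendsto M f (𝓝 M₀)) (hv : Tendsto v f (𝓝 v₀)) :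
    Tendsto (fun a => M a *ᵥ v a) f (𝓝 (M₀ *ᵥ v₀)) :=
  ((continuous_fst.matrix_mulVec continuous_snd).tendsto (M₀, v₀)).comp (hM.prodMk_nhds hv)

theorem Filter.Tendsto.matrix_inv [DecidableEq κ] {M : α → Matrix κ κ ℝ} {M₀ : Matrix κ κ ℝ}
    (hM : Tendsto M f (𝓝 M₀)) (h : IsUnit M₀.det) :
    Tendsto (fun a => (M a)⁻¹) f (𝓝 M₀⁻¹) := by
  refine (continuousAt_matrix_inv M₀ ?_).tendsto.comp hM
  simpa only [Ring.inverse_eq_inv'] using continuousAt_inv₀ h.ne_zero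

end Tendsto

section Stein

variable {ι κ : Type*} [Fintype ι] [DecidableEq ι] [Fintype κ] [DecidableEq κ]
  {A : Matrix ι ι ℝ} {B : Matrix κ κ ℝ}

theorem eq_pow_mul_mul_pow {X : Matrix ι κ ℝ} (h : A * X * B = X) (k : ℕ) :
    A ^ k * X * B ^ k = X := by
  induction k with
  | zero => simp
  | succ k ih =>
    calc A ^ (k + 1) * X * B ^ (k + 1) = A ^ k * (A * X * B) * B ^ k := by
          rw [pow_succ, pow_succ']; simp only [Matrix.mul_assoc]
      _ = X := by rw [h, ih]

/-- Iterating gives `X = A ^ k X B ^ k` for all `k`, and the right side tends to `0`. -/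
theorem eq_zero_of_stein (hA : IsSchur A) (hB : IsSchur B) {X : Matrix ι κ ℝ} (h : A * X * B = X) :
    X = 0 := by
  have h1 : Filter.Tendsto (fun k : ℕ => A ^ k * X * B ^ k) Filter.atTop 
      (nhds ((0 : Matrix ι ι ℝ) * X * (0 : Matrix κ κ ℝ))) :=
    (hA.tendsto_pow.matrix_mul' tendsto_const_nhds).matrix_mul' hB.tendsto_pow
  simp only [eq_pow_mul_mul_pow h, Matrix.mul_zero] at h1
  exact tendsto_nhds_unique tendsto_const_nhds h1

/-- The map `X ↦ X - A X B` is an injective endomorphism of a finite-dimensional space, hence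
bijective. -/
theorem existsUnique_stein (hA : IsSchur A) (hB : IsSchur B) (Q : Matrix ι κ ℝ) :
    ∃! X : Matrix ι κ ℝ, Q + A * X * B = X := by
  let f : Matrix ι κ ℝ →ₗ[ℝ] Matrix ι κ ℝ :=
    { toFun X := X - A * X * B
      map_add' X Y := by rw [Matrix.mul_add, Matrix.add_mul]; abel
      map_smul' a X := by simp [smul_sub] }
  have hinj : Function.Injective f := by
    rw [injective_iff_map_eq_zero]
    intro X hX
    exact eq_zero_of_stein hA hB (sub_eq_zero.1 hX).symm
  obtain ⟨X, hX⟩ := LinearMap.injective_iff_surjective.1 hinj Q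
  have hiff : ∀ Y, Q + A * Y * B = Y ↔ f Y = Q := fun Y =>
    ⟨fun h => sub_eq_iff_eq_add.2 h.symm, fun h => (sub_eq_iff_eq_add.1 h).symm⟩
  exact ⟨X, (hiff X).2 hX, fun Y hY => hinj (((hiff Y).1 hY).trans hX.symm)⟩

end Stein

/-! ### The Riccati equation -/

section Riccati

variable {dx du ds : ℕ} {A : Matrix (Fin dx) (Fin dx) ℝ} {Bu : Matrix (Fin dx) (Fin du) ℝ}
  {C : Matrix (Fin ds) (Fin dx) ℝ} {P Q : Matrix (Fin dx) (Fin dx) ℝ}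

theorem gainInv_mul (hS : IsUnit (1 + Buᵀ * P * Bu).det) : gainInv Bu P * (1 + Buᵀ * P * Bu) = 1 :=
  Matrix.nonsing_inv_mul _ hS

theorem mul_gainInv (hS : IsUnit (1 + Buᵀ * P * Bu).det) : (1 + Buᵀ * P * Bu) * gainInv Bu P = 1 :=
  Matrix.mul_nonsing_inv _ hS

theorem mul_lqrGain (hS : IsUnit (1 + Buᵀ * P * Bu).det) :
    (1 + Buᵀ * P * Bu) * lqrGain A Bu P = Buᵀ * P * A := by
  simp only [lqrGain, ← Matrix.mul_assoc, mul_gainInv hS, Matrix.one_mul]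

theorem lqrGain_transpose_mul (hP : P.IsSymm) (hS : IsUnit (1 + Buᵀ * P * Bu).det) :
    (lqrGain A Bu P)ᵀ * (1 + Buᵀ * P * Bu) = Aᵀ * P * Bu := by
  have := congrArg Matrix.transpose (mul_lqrGain (A := A) hS)
  simpa [Matrix.transpose_mul, Matrix.transpose_add, hP.eq, Matrix.mul_assoc] using this

theorem gain_eq_closedLoop (hS : IsUnit (1 + Buᵀ * P * Bu).det) :
    Buᵀ * P * closedLoop A Bu P = lqrGain A Bu P := by
  have := mul_lqrGain (A := A) hS
  rw [Matrix.add_mul, Matrix.one_mul] at this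
  rw [closedLoop, Matrix.mul_sub, ← this, ← Matrix.mul_assoc]
  abel

theorem gain_eq_closedLoop' (hP : P.IsSymm) (hS : IsUnit (1 + Buᵀ * P * Bu).det) :
    (closedLoop A Bu P)ᵀ * P * Bu = (lqrGain A Bu P)ᵀ := by
  have := congrArg Matrix.transpose (gain_eq_closedLoop (A := A) hS)
  simpa [Matrix.transpose_mul, hP.eq, Matrix.mul_assoc] using this

namespace DRRO.IsStabilizingRiccati

/-- This form and its transpose `eq_add'` contain one open-loop and one closed-loop factor;
combined, they make the difference of two Riccati solutions satisfy a linear equation. -/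
theorem eq_add (hP : IsStabilizingRiccati A Bu C P) :
    P = Cᵀ * C + Aᵀ * P * closedLoop A Bu P := by
  conv_lhs => rw [hP.2.2.1]
  rw [closedLoop, Matrix.mul_sub, lqrGain]
  simp only [Matrix.mul_assoc]
  abel

theorem eq_add' (hP : IsStabilizingRiccati A Bu C P) :
    P = Cᵀ * C + (closedLoop A Bu P)ᵀ * P * A := by
  have := congrArg Matrix.transpose hP.eq_add
  simpa [Matrix.transpose_mul, hP.1.eq, Matrix.mul_assoc] using this

/-- The difference solves the homogeneous Stein equation `A_k(P)ᵀ (P - Q) A_k(Q) = P - Q`: the terms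
in which the two gains multiply each other cancel. Both closed loops are Schur. -/
theorem unique (hP : IsStabilizingRiccati A Bu C P) (hQ : IsStabilizingRiccati A Bu C Q) :
    Q = P := by
  refine (sub_eq_zero.1 (eq_zero_of_stein hP.2.2.2.transpose hQ.2.2.2 ?_)).symm
  have h1 := gain_eq_closedLoop' (A := A) hP.1 hP.2.1
  have h2 := gain_eq_closedLoop (A := A) hQ.2.1
  calc (closedLoop A Bu P)ᵀ * (P - Q) * closedLoop A Bu Q
      = (closedLoop A Bu P)ᵀ * P * closedLoop A Bu Q - (closedLoop A Bu P)ᵀ * (Q * closedLoop A Bu Q) := by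
        simp only [Matrix.mul_sub, Matrix.sub_mul, Matrix.mul_assoc]
    _ = ((closedLoop A Bu P)ᵀ * P * A - (closedLoop A Bu P)ᵀ * P * Bu * lqrGain A Bu Q) -
        (Aᵀ * Q * closedLoop A Bu Q - (lqrGain A Bu P)ᵀ * (Buᵀ * Q * closedLoop A Bu Q)) := by
        congr 1
        · conv_lhs => rw [closedLoop.eq_def A Bu Q]
          simp only [Matrix.mul_sub, Matrix.mul_assoc]
        · conv_lhs => enter [1]; rw [closedLoop]
          simp only [Matrix.transpose_sub, Matrix.transpose_mul, Matrix.sub_mul, Matrix.mul_assoc]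
    _ = (closedLoop A Bu P)ᵀ * P * A - Aᵀ * Q * closedLoop A Bu Q := by
        rw [h1, h2]; abel
    _ = P - Q := by
        conv_rhs => rw [hP.eq_add', hQ.eq_add]
        abel

end DRRO.IsStabilizingRiccati

/-- The cost-to-go of the feedback `u = -G x` for one step, followed by the terminal cost `P`. -/
def feedbackCost (A : Matrix (Fin dx) (Fin dx) ℝ) (Bu : Matrix (Fin dx) (Fin du) ℝ)
    (C : Matrix (Fin ds) (Fin dx) ℝ) (G : Matrix (Fin du) (Fin dx) ℝ)
    (P : Matrix (Fin dx) (Fin dx) ℝ) : Matrix (Fin dx) (Fin dx) ℝ :=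
  Cᵀ * C + Gᵀ * G + (A - Bu * G)ᵀ * P * (A - Bu * G)

theorem dotProduct_transpose_mul_mulVec {ι κ l : Type*} [Fintype ι] [Fintype κ] [Fintype l]
    (M : Matrix l ι ℝ) (N : Matrix l κ ℝ) (x : ι → ℝ) (y : κ → ℝ) :
    x ⬝ᵥ (Mᵀ * N) *ᵥ y = (M *ᵥ x) ⬝ᵥ (N *ᵥ y) := by
  rw [← Matrix.mulVec_mulVec, Matrix.mulVec_transpose, dotProduct_comm,
    ← Matrix.dotProduct_mulVec, dotProduct_comm]

theorem dotProduct_feedbackCost (G : Matrix (Fin du) (Fin dx) ℝ) (x : Fin dx → ℝ) :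
    x ⬝ᵥ feedbackCost A Bu C G P *ᵥ x = C *ᵥ x ⬝ᵥ C *ᵥ x + G *ᵥ x ⬝ᵥ G *ᵥ x +
      (A - Bu * G) *ᵥ x ⬝ᵥ P *ᵥ ((A - Bu * G) *ᵥ x) := by
  rw [feedbackCost, Matrix.add_mulVec, Matrix.add_mulVec, dotProduct_add, dotProduct_add,
    Matrix.mul_assoc]
  simp only [dotProduct_transpose_mul_mulVec]
  rw [Matrix.mulVec_mulVec]

/-- Completion of the square. -/
theorem feedbackCost_eq (hP : P.IsSymm) (hS : IsUnit (1 + Buᵀ * P * Bu).det)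
    (G : Matrix (Fin du) (Fin dx) ℝ) :
    feedbackCost A Bu C G P = feedbackCost A Bu C (lqrGain A Bu P) P +
      (G - lqrGain A Bu P)ᵀ * (1 + Buᵀ * P * Bu) * (G - lqrGain A Bu P) := by
  have h1 := mul_lqrGain (A := A) hS
  have h2 := lqrGain_transpose_mul (A := A) hP hS
  have key : ∀ G : Matrix (Fin du) (Fin dx) ℝ, feedbackCost A Bu C G P = Cᵀ * C + Aᵀ * P * A -
      (lqrGain A Bu P)ᵀ * (1 + Buᵀ * P * Bu) * G - Gᵀ * ((1 + Buᵀ * P * Bu) * lqrGain A Bu P) +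
      Gᵀ * (1 + Buᵀ * P * Bu) * G := by
    intro G
    rw [h1, h2, feedbackCost]
    simp only [Matrix.transpose_sub, Matrix.transpose_mul, Matrix.sub_mul, Matrix.mul_sub,
      Matrix.add_mul, Matrix.mul_add, Matrix.mul_assoc, Matrix.one_mul]
    abel
  rw [key, key]
  simp only [Matrix.transpose_sub, Matrix.sub_mul, Matrix.mul_sub, Matrix.mul_assoc]
  abel

theorem feedbackCost_lqrGain (hP : P.IsSymm) (hS : IsUnit (1 + Buᵀ * P * Bu).det) :
    feedbackCost A Bu C (lqrGain A Bu P) P =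
      Cᵀ * C + Aᵀ * P * A - Aᵀ * P * Bu * gainInv Bu P * Buᵀ * P * A := by
  -- At zero gain the completed square reads `C*C + A*PA = (minimal cost) + K_lqrᵀ S K_lqr`.
  have h1 := feedbackCost_eq (A := A) (C := C) hP hS (0 : Matrix (Fin du) (Fin dx) ℝ)
  rw [← sub_eq_iff_eq_add] at h1
  rw [← h1]
  have h2 := lqrGain_transpose_mul (A := A) hP hS
  simp only [zero_sub, Matrix.transpose_neg, Matrix.neg_mul, Matrix.mul_neg, neg_neg, h2]
  simp [feedbackCost, lqrGain, Matrix.mul_assoc]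

theorem isUnit_det_of_posSemidef (hP : P.PosSemidef) : IsUnit (1 + Buᵀ * P * Bu).det := by
  have h := hP.conjTranspose_mul_mul_same Bu
  rw [Matrix.conjTranspose_eq_transpose_of_trivial] at h
  exact (Matrix.isUnit_iff_isUnit_det _).1 (Matrix.PosDef.one.add_posSemidef h).isUnit

theorem posSemidef_feedbackCost (G : Matrix (Fin du) (Fin dx) ℝ) (hP : P.PosSemidef) :
    (feedbackCost A Bu C G P).PosSemidef := by
  have h1 := Matrix.posSemidef_conjTranspose_mul_self C
  have h2 := Matrix.posSemidef_conjTranspose_mul_self G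
  have h3 := hP.conjTranspose_mul_mul_same (A - Bu * G)
  simp only [Matrix.conjTranspose_eq_transpose_of_trivial] at h1 h2 h3
  exact (h1.add h2).add h3

/-- The excess in the completed square is a quadratic form in `S`, which is positive. This
minimality drives both the monotonicity and the bound in the value iteration. -/
theorem dotProduct_feedbackCost_lqrGain_le (hP : P.PosSemidef) (G : Matrix (Fin du) (Fin dx) ℝ)
    (x : Fin dx → ℝ) : x ⬝ᵥ feedbackCost A Bu C (lqrGain A Bu P) P *ᵥ x ≤
      x ⬝ᵥ feedbackCost A Bu C G P *ᵥ x := by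
  have hsymm : P.IsSymm := by simpa using hP.isHermitian
  rw [feedbackCost_eq hsymm (isUnit_det_of_posSemidef hP) G, Matrix.add_mulVec, dotProduct_add,
    le_add_iff_nonneg_right]
  have h := (hP.conjTranspose_mul_mul_same Bu)
  rw [Matrix.conjTranspose_eq_transpose_of_trivial] at h
  have := ((Matrix.PosDef.one.add_posSemidef h).posSemidef.conjTranspose_mul_mul_same
    (G - lqrGain A Bu P)).dotProduct_mulVec_nonneg x
  simpa using this

end Riccati

theorem real_dotProduct_self_nonneg {ι : Type*} [Fintype ι] (v : ι → ℝ) : 0 ≤ v ⬝ᵥ v :=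
  Finset.sum_nonneg fun i _ => mul_self_nonneg (v i)

/-! ### Existence of the stabilizing Riccati solution by value iteration -/

section RiccatiExistence

variable {dx du ds : ℕ} {A : Matrix (Fin dx) (Fin dx) ℝ} {Bu : Matrix (Fin dx) (Fin du) ℝ}
  {C : Matrix (Fin ds) (Fin dx) ℝ} {P : Matrix (Fin dx) (Fin dx) ℝ}
  {G : Matrix (Fin du) (Fin dx) ℝ}

/-- Here `x` and `y` are the real and imaginary parts of a closed-loop eigenvector for `a + ib`. In
the sum of the two cost identities the cross terms cancel, so the running costs add up to `(1 - |a +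
ib|²)` times a nonnegative number, which is at most `0`. -/
theorem mulVec_eq_zero_of_feedbackCost (hP : P.PosSemidef) (hG : feedbackCost A Bu C G P = P)
    {x y : Fin dx → ℝ} {a b : ℝ} (hab : 1 ≤ a ^ 2 + b ^ 2)
    (hx : (A - Bu * G) *ᵥ x = a • x - b • y) (hy : (A - Bu * G) *ᵥ y = a • y + b • x) :
    C *ᵥ x = 0 ∧ G *ᵥ x = 0 ∧ C *ᵥ y = 0 ∧ G *ᵥ y = 0 := by
  have hx1 := dotProduct_feedbackCost (A := A) (Bu := Bu) (C := C) (P := P) G x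
  have hy1 := dotProduct_feedbackCost (A := A) (Bu := Bu) (C := C) (P := P) G y
  rw [hG, hx] at hx1
  rw [hG, hy] at hy1
  have hx0 : 0 ≤ x ⬝ᵥ P *ᵥ x := by simpa using hP.dotProduct_mulVec_nonneg x
  have hy0 : 0 ≤ y ⬝ᵥ P *ᵥ y := by simpa using hP.dotProduct_mulVec_nonneg y
  simp only [Matrix.mulVec_sub, Matrix.mulVec_add, Matrix.mulVec_smul, dotProduct_sub,
    dotProduct_add, sub_dotProduct, add_dotProduct, smul_dotProduct, dotProduct_smul,
    smul_eq_mul] at hx1 hy1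
  have n1 : 0 ≤ C *ᵥ x ⬝ᵥ C *ᵥ x := real_dotProduct_self_nonneg _
  have n2 : 0 ≤ G *ᵥ x ⬝ᵥ G *ᵥ x := real_dotProduct_self_nonneg _
  have n3 : 0 ≤ C *ᵥ y ⬝ᵥ C *ᵥ y := real_dotProduct_self_nonneg _
  have n4 : 0 ≤ G *ᵥ y ⬝ᵥ G *ᵥ y := real_dotProduct_self_nonneg _
  have hsum : C *ᵥ x ⬝ᵥ C *ᵥ x + G *ᵥ x ⬝ᵥ G *ᵥ x + C *ᵥ y ⬝ᵥ C *ᵥ y + G *ᵥ y ⬝ᵥ G *ᵥ y =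
      (1 - (a ^ 2 + b ^ 2)) * (x ⬝ᵥ P *ᵥ x + y ⬝ᵥ P *ᵥ y) := by linarith
  have hle := mul_nonneg (sub_nonneg.2 hab) (add_nonneg hx0 hy0)
  simp only [← dotProduct_self_eq_zero]
  refine ⟨?_, ?_, ?_, ?_⟩ <;> linarith

theorem mulVec_pow_eq_zero {x y : Fin dx → ℝ} {a b : ℝ}
    (hx : A *ᵥ x = a • x - b • y) (hy : A *ᵥ y = a • y + b • x) (hCx : C *ᵥ x = 0)
    (hCy : C *ᵥ y = 0) (k : ℕ) : (C * A ^ k) *ᵥ x = 0 ∧ (C * A ^ k) *ᵥ y = 0 := by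
  induction k with
  | zero => simpa using ⟨hCx, hCy⟩
  | succ k ih =>
    have h (v : Fin dx → ℝ) : (C * A ^ (k + 1)) *ᵥ v = (C * A ^ k) *ᵥ (A *ᵥ v) := by
      rw [pow_succ, ← Matrix.mul_assoc, Matrix.mulVec_mulVec]
    rw [h, h, hx, hy]
    simp [Matrix.mulVec_sub, Matrix.mulVec_add, Matrix.mulVec_smul, ih.1, ih.2]

/-- Since the gain vanishes on `x` and `y`, the closed loop acts on them as `A` does; their span is
then `A`-invariant and killed by `C`, against observability. -/
theorem eq_zero_of_feedbackCost (hobs : IsObservable A C) (hP : P.PosSemidef)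
    (hG : feedbackCost A Bu C G P = P) {x y : Fin dx → ℝ} {a b : ℝ} (hab : 1 ≤ a ^ 2 + b ^ 2)
    (hx : (A - Bu * G) *ᵥ x = a • x - b • y) (hy : (A - Bu * G) *ᵥ y = a • y + b • x) :
    x = 0 ∧ y = 0 := by
  obtain ⟨h1, h2, h3, h4⟩ := mulVec_eq_zero_of_feedbackCost hP hG hab hx hy
  rw [Matrix.sub_mulVec, ← Matrix.mulVec_mulVec, h2, Matrix.mulVec_zero, sub_zero] at hx
  rw [Matrix.sub_mulVec, ← Matrix.mulVec_mulVec, h4, Matrix.mulVec_zero, sub_zero] at hy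
  have := mulVec_pow_eq_zero hx hy h1 h3
  exact ⟨hobs x fun k => (this k).1, hobs y fun k => (this k).2⟩

theorem isSchur_of_feedbackCost (hobs : IsObservable A C) (hP : P.PosSemidef)
    (hG : feedbackCost A Bu C G P = P) : IsSchur (A - Bu * G) := by
  refine isSchur_of_eigenvector fun μ v hv hμ => ?_
  by_contra hlt
  have hab : 1 ≤ μ.re ^ 2 + μ.im ^ 2 := by
    have := Complex.sq_norm μ
    rw [Complex.normSq_apply] at this
    nlinarith [not_lt.1 hlt, norm_nonneg μ]
  have hre : ∀ (M : Matrix (Fin dx) (Fin dx) ℝ) (i : Fin dx),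
      (M *ᵥ fun i => (v i).re) i = ((cplx M *ᵥ v) i).re := fun M i => by
    simp [Matrix.mulVec, dotProduct]
  have him : ∀ (M : Matrix (Fin dx) (Fin dx) ℝ) (i : Fin dx),
      (M *ᵥ fun i => (v i).im) i = ((cplx M *ᵥ v) i).im := fun M i => by
    simp [Matrix.mulVec, dotProduct]
  obtain ⟨h1, h2⟩ := eq_zero_of_feedbackCost hobs hP hG (x := fun i => (v i).re)
    (y := fun i => (v i).im) hab (by ext i; simp [hre, hμ])
    (by ext i; simp [him, hμ])
  exact hv (funext fun i => Complex.ext (congrFun h1 i) (congrFun h2 i))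

/-- If `xᵀ P x = 0`, all terms of the cost identity vanish: `C x = 0`, the gain is zero on `x`, and
`A x` is again such a vector. Observability then gives `x = 0`. -/
theorem posDef_of_feedbackCost (hobs : IsObservable A C) (hP : P.PosSemidef)
    (hG : feedbackCost A Bu C G P = P) : P.PosDef := by
  refine Matrix.PosDef.of_dotProduct_mulVec_pos hP.isHermitian fun x hx => ?_
  refine lt_of_le_of_ne (hP.dotProduct_mulVec_nonneg x) fun h0 => hx ?_
  have hker : ∀ y : Fin dx → ℝ, y ⬝ᵥ P *ᵥ y = 0 → C *ᵥ y = 0 ∧ A *ᵥ y ⬝ᵥ P *ᵥ (A *ᵥ y) = 0 := by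
    intro y hy
    have hy1 := dotProduct_feedbackCost (A := A) (Bu := Bu) (C := C) (P := P) G y
    rw [hG, hy] at hy1
    have n1 : 0 ≤ C *ᵥ y ⬝ᵥ C *ᵥ y := real_dotProduct_self_nonneg _
    have n2 : 0 ≤ G *ᵥ y ⬝ᵥ G *ᵥ y := real_dotProduct_self_nonneg _
    have n3 : 0 ≤ (A - Bu * G) *ᵥ y ⬝ᵥ P *ᵥ ((A - Bu * G) *ᵥ y) := by
      simpa using hP.dotProduct_mulVec_nonneg ((A - Bu * G) *ᵥ y)
    have e2 : G *ᵥ y = 0 := dotProduct_self_eq_zero.1 (by linarith)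
    have e3 : (A - Bu * G) *ᵥ y = A *ᵥ y := by
      rw [Matrix.sub_mulVec, ← Matrix.mulVec_mulVec, e2, Matrix.mulVec_zero, sub_zero]
    rw [e3] at hy1 n3
    exact ⟨dotProduct_self_eq_zero.1 (by linarith), by linarith⟩
  have hpow : ∀ k : ℕ, (A ^ k *ᵥ x) ⬝ᵥ P *ᵥ (A ^ k *ᵥ x) = 0 := by
    intro k
    induction k with
    | zero => simpa using h0.symm
    | succ k ih => simpa [pow_succ', Matrix.mulVec_mulVec] using (hker _ ih).2
  exact hobs x fun k => by rw [← Matrix.mulVec_mulVec]; exact (hker _ (hpow k)).1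

/-- The cost of a stabilizing feedback. -/
theorem exists_feedbackCost_eq (hG : IsSchur (A - Bu * G)) :
    ∃ M : Matrix (Fin dx) (Fin dx) ℝ, M.PosSemidef ∧ feedbackCost A Bu C G M = M := by
  obtain ⟨M, hM, huniq⟩ := existsUnique_stein hG.transpose hG (Cᵀ * C + Gᵀ * G)
  have hM' : feedbackCost A Bu C G M = M := hM
  -- The transpose solves the same Stein equation.
  have hsymm : Mᵀ = M := huniq _ (by
    have := congrArg Matrix.transpose hM
    simpa [Matrix.transpose_mul, Matrix.transpose_add, Matrix.mul_assoc] using this)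
  refine ⟨M, .of_dotProduct_mulVec_nonneg (by simpa [Matrix.IsHermitian] using hsymm)
    fun x => ?_, hM⟩
  -- The cost-to-go decreases along closed-loop trajectories and tends to `0`, so it was nonnegative
  -- at the start.
  have hle : ∀ k : ℕ, ((A - Bu * G) ^ k *ᵥ x) ⬝ᵥ M *ᵥ ((A - Bu * G) ^ k *ᵥ x) ≤ x ⬝ᵥ M *ᵥ x := by
    intro k
    induction k with
    | zero => simp
    | succ k ih =>
      refine le_trans ?_ ih
      have := dotProduct_feedbackCost (A := A) (Bu := Bu) (C := C) (P := M) G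
        ((A - Bu * G) ^ k *ᵥ x)
      rw [hM'] at this
      rw [this, pow_succ', ← Matrix.mulVec_mulVec]
      have n1 := real_dotProduct_self_nonneg (C *ᵥ (A - Bu * G) ^ k *ᵥ x)
      have n2 := real_dotProduct_self_nonneg (G *ᵥ (A - Bu * G) ^ k *ᵥ x)
      linarith
  have h1 : Filter.Tendsto (fun k : ℕ => (A - Bu * G) ^ k *ᵥ x) Filter.atTop (nhds 0) := by
    simpa using hG.tendsto_pow.matrix_mulVec' (tendsto_const_nhds (x := x))
  have h2 : Filter.Tendsto (fun k : ℕ => ((A - Bu * G) ^ k *ᵥ x) ⬝ᵥ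
      M *ᵥ ((A - Bu * G) ^ k *ᵥ x)) Filter.atTop (nhds 0) := by
    have hc : Continuous fun y : Fin dx → ℝ => y ⬝ᵥ M *ᵥ y :=
      continuous_id.dotProduct (continuous_const.matrix_mulVec continuous_id)
    have := (hc.tendsto 0).comp h1
    rwa [Matrix.mulVec_zero, dotProduct_zero] at this
  simpa using le_of_tendsto' h2 hle

open Filter Topology in
-- Each quadratic form converges, being monotone and bounded; polarization at `e i + e j` recovers
-- the entries, by symmetry.
theorem exists_tendsto_of_monotone {ι : Type*} [Fintype ι] [DecidableEq ι] {p : ℕ → Matrix ι ι ℝ}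
    (hsymm : ∀ k, (p k).IsSymm) (hmono : ∀ x : ι → ℝ, Monotone fun k => x ⬝ᵥ p k *ᵥ x)
    (hbdd : ∀ x : ι → ℝ, BddAbove (Set.range fun k => x ⬝ᵥ p k *ᵥ x)) :
    ∃ P : Matrix ι ι ℝ, Tendsto p atTop (𝓝 P) := by
  have hlim : ∀ x : ι → ℝ, ∃ l, Tendsto (fun k => x ⬝ᵥ p k *ᵥ x) atTop (𝓝 l) :=
    fun x => ⟨_, tendsto_atTop_ciSup (hmono x) (hbdd x)⟩
  choose l hl using hlim
  let e (i : ι) : ι → ℝ := Pi.single i 1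
  refine ⟨.of fun i j => (l (e i + e j) - l (e i) - l (e j)) / 2,
    tendsto_pi_nhds.2 fun i => tendsto_pi_nhds.2 fun j => ?_⟩
  have := (((hl (e i + e j)).sub (hl (e i))).sub (hl (e j))).div_const 2
  refine this.congr fun k => ?_
  have hij : p k j i = p k i j := (hsymm k).apply i j
  simp only [e, Matrix.mulVec_add, dotProduct_add, add_dotProduct, Matrix.mulVec_single_one,
    single_one_dotProduct, Matrix.col_apply, hij]
  ring

open Filter Topology in
-- The iterates `p k` are optimal costs over `k` steps with no terminal cost. They increase with `k`
-- and stay below the cost `M` of any stabilizing feedback, so they converge; by continuity the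
-- limit is a fixed point of the Riccati map.
theorem exists_posDef_isStabilizingRiccati (hstab : IsStabilizable A Bu) (hobs : IsObservable A C) :
    ∃ P : Matrix (Fin dx) (Fin dx) ℝ, P.PosDef ∧ IsStabilizingRiccati A Bu C P := by
  obtain ⟨G, hG⟩ := hstab
  obtain ⟨M, hM, hMeq⟩ := exists_feedbackCost_eq (C := C) hG
  let step (P : Matrix (Fin dx) (Fin dx) ℝ) := feedbackCost A Bu C (lqrGain A Bu P) P
  let p (k : ℕ) : Matrix (Fin dx) (Fin dx) ℝ := step^[k] 0
  have hp : ∀ k, p (k + 1) = step (p k) := fun k => Function.iterate_succ_apply' step k 0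
  have hpsd : ∀ k, (p k).PosSemidef := by
    intro k
    induction k with
    | zero => exact .zero
    | succ k ih => rw [hp]; exact posSemidef_feedbackCost _ ih
  have hsymm : ∀ k, (p k).IsSymm := fun k => by simpa using (hpsd k).isHermitian
  have hcost : ∀ (G : Matrix (Fin du) (Fin dx) ℝ) (P Q : Matrix (Fin dx) (Fin dx) ℝ),
      (∀ x, x ⬝ᵥ P *ᵥ x ≤ x ⬝ᵥ Q *ᵥ x) →
      ∀ x, x ⬝ᵥ feedbackCost A Bu C G P *ᵥ x ≤ x ⬝ᵥ feedbackCost A Bu C G Q *ᵥ x := by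
    intro G P Q h x
    rw [dotProduct_feedbackCost, dotProduct_feedbackCost]
    gcongr
    exact h _
  have hmono : ∀ k x, x ⬝ᵥ p k *ᵥ x ≤ x ⬝ᵥ p (k + 1) *ᵥ x := by
    intro k
    induction k with
    | zero => intro x; simpa [p] using (hpsd 1).dotProduct_mulVec_nonneg x
    | succ k ih =>
      intro x
      rw [hp k, hp (k + 1)]
      exact (dotProduct_feedbackCost_lqrGain_le (hpsd k) _ x).trans (hcost _ _ _ ih x)
  have hbdd : ∀ k x, x ⬝ᵥ p k *ᵥ x ≤ x ⬝ᵥ M *ᵥ x := by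
    intro k
    induction k with
    | zero => intro x; simpa [p] using hM.dotProduct_mulVec_nonneg x
    | succ k ih =>
      intro x
      rw [hp k]
      exact (dotProduct_feedbackCost_lqrGain_le (hpsd k) G x).trans
        ((hcost _ _ _ ih x).trans_eq (by rw [hMeq]))
  obtain ⟨P, hP⟩ := exists_tendsto_of_monotone hsymm
    (fun x => monotone_nat_of_le_succ fun k => hmono k x)
    (fun x => ⟨_, Set.forall_mem_range.2 fun k => hbdd k x⟩)
  have hPsymm : P.IsSymm :=
    tendsto_nhds_unique ((continuous_id.matrix_transpose.tendsto P).comp hP)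
      (hP.congr fun k => (hsymm k).eq.symm)
  have hPpsd : P.PosSemidef :=
    .of_dotProduct_mulVec_nonneg (by simpa [Matrix.IsHermitian] using hPsymm.eq) fun x => by
      have hc : Continuous fun Q : Matrix (Fin dx) (Fin dx) ℝ => star x ⬝ᵥ Q *ᵥ x :=
        continuous_const.dotProduct (continuous_id.matrix_mulVec continuous_const)
      exact ge_of_tendsto' ((hc.tendsto P).comp hP) fun k => (hpsd k).dotProduct_mulVec_nonneg x
  -- Invertibility of `S` at the limit is what makes the gain, and hence the Riccati map, continuous
  -- there.
  have hS := isUnit_det_of_posSemidef (Bu := Bu) hPpsd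
  have hBP : Tendsto (fun k => Buᵀ * p k) atTop (𝓝 (Buᵀ * P)) := tendsto_const_nhds.matrix_mul' hP
  have hK : Tendsto (fun k => lqrGain A Bu (p k)) atTop (𝓝 (lqrGain A Bu P)) := by
    have h1 : Tendsto (fun k => gainInv Bu (p k)) atTop (𝓝 (gainInv Bu P)) :=
      (tendsto_const_nhds.add (hBP.matrix_mul' tendsto_const_nhds)).matrix_inv hS
    exact ((h1.matrix_mul' tendsto_const_nhds).matrix_mul' hP).matrix_mul' tendsto_const_nhds
  have hKt : Tendsto (fun k => (lqrGain A Bu (p k))ᵀ) atTop (𝓝 (lqrGain A Bu P)ᵀ) :=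
    (continuous_id.matrix_transpose.tendsto _).comp hK
  have hcl : Tendsto (fun k => A - Bu * lqrGain A Bu (p k)) atTop (𝓝 (A - Bu * lqrGain A Bu P)) :=
    tendsto_const_nhds.sub (tendsto_const_nhds.matrix_mul' hK)
  have hclt : Tendsto (fun k => (A - Bu * lqrGain A Bu (p k))ᵀ) atTop
      (𝓝 (A - Bu * lqrGain A Bu P)ᵀ) := (continuous_id.matrix_transpose.tendsto _).comp hcl
  have hstep : Tendsto (fun k => step (p k)) atTop (𝓝 (step P)) :=
    (tendsto_const_nhds.add (hKt.matrix_mul' hK)).add ((hclt.matrix_mul' hP).matrix_mul' hcl)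
  have hfix : step P = P :=
    tendsto_nhds_unique hstep (((tendsto_add_atTop_iff_nat 1).2 hP).congr hp)
  refine ⟨P, posDef_of_feedbackCost hobs hPpsd hfix, hPsymm, hS, ?_,
    isSchur_of_feedbackCost hobs hPpsd hfix⟩
  rw [← feedbackCost_lqrGain hPsymm hS]
  exact hfix.symm

end RiccatiExistence

/-! ### Realization of the rational spectral factor -/

section Companion

/-- The companion matrix of `z ^ m + c 1 * z ^ (m - 1) + ⋯ + c m`. -/
def companion (m : ℕ) (c : ℕ → ℝ) : Matrix (Fin m) (Fin m) ℝ :=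
  .of fun i j => if (i : ℕ) = 0 then -c (j + 1) else if (i : ℕ) = j + 1 then 1 else 0

/-- The first unit vector, as a column. -/
def firstColumn (m : ℕ) : Matrix (Fin m) (Fin 1) ℝ :=
  .of fun i _ => if (i : ℕ) = 0 then 1 else 0

/-- The output row `d 1 - c 1, …, d m - c m`. -/
def coeffRow (m : ℕ) (c d : ℕ → ℝ) : Matrix (Fin 1) (Fin m) ℝ :=
  .of fun _ j => d (j + 1) - c (j + 1)

/-- `1 + c 1 * ζ + ⋯ + c m * ζ ^ m` -/
noncomputable def monicRev (m : ℕ) (c : ℕ → ℝ) (ζ : ℂ) : ℂ :=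
  1 + ∑ j : Fin m, (c (j + 1) : ℂ) * ζ ^ ((j : ℕ) + 1)

theorem aeval_eq_monicRev {m : ℕ} {b : ℝ[X]} (hb : b.natDegree ≤ m) (hb0 : b.coeff 0 ≠ 0) (ζ : ℂ) :
    Polynomial.aeval ζ b = (b.coeff 0 : ℂ) * monicRev m (fun i => b.coeff i / b.coeff 0) ζ := by
  have hb0' : (b.coeff 0 : ℂ) ≠ 0 := by exact_mod_cast hb0
  rw [Polynomial.aeval_eq_sum_range' (Nat.lt_succ_of_le hb), Finset.sum_range_succ', monicRev,
    mul_add, Finset.mul_sum, Finset.sum_range, add_comm]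
  simp only [Complex.real_smul, Complex.ofReal_div, pow_zero, mul_one]
  congr 1
  refine Finset.sum_congr rfl fun j _ => ?_
  field_simp

/-- The rank-one correction changes only the first row. Thus, when `Ã` is the companion matrix of
the denominator, `Ã - B̃ C̃` is that of the numerator. -/
theorem companion_sub (m : ℕ) (c d : ℕ → ℝ) :
    companion m c - firstColumn m * coeffRow m c d =
      companion m d := by
  ext i j
  by_cases hi : (i : ℕ) = 0
  · simp [companion, firstColumn, coeffRow, Matrix.mul_apply, hi]
    ring
  · simp [companion, firstColumn, Matrix.mul_apply, hi]

theorem companion_mulVec_zero {m : ℕ} (c : ℕ → ℝ) (v : Fin m → ℂ) {i : Fin m} (hi : (i : ℕ) = 0) :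
    (cplx (companion m c) *ᵥ v) i = -∑ j : Fin m, (c (j + 1) : ℂ) * v j := by
  simp [Matrix.mulVec, dotProduct, companion, hi]

theorem companion_mulVec_succ {m : ℕ} (c : ℕ → ℝ) (v : Fin m → ℂ) {i j : Fin m}
    (hi : (i : ℕ) = j + 1) : (cplx (companion m c) *ᵥ v) i = v j := by
  have h (k : Fin m) : (j : ℕ) = k ↔ j = k := Fin.val_inj
  simp [Matrix.mulVec, dotProduct, companion, hi, h, apply_ite Complex.ofReal]

/-- The shift rows force an eigenvector to be `v k = μ⁻¹ ^ k v 0`; the first row then says that the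
reversed polynomial vanishes at `μ⁻¹`, which lies in the closed disc if `‖μ‖ ≥ 1`. -/
theorem isSchur_companion {m : ℕ} {c : ℕ → ℝ} (h : ∀ ζ : ℂ, ‖ζ‖ ≤ 1 → monicRev m c ζ ≠ 0) :
    IsSchur (companion m c) := by
  refine isSchur_of_eigenvector fun μ v hv hμ => ?_
  by_contra hlt
  rw [not_lt] at hlt
  have hμ0 : μ ≠ 0 := by rintro rfl; norm_num at hlt
  cases m with
  | zero => exact hv (Subsingleton.elim _ _)
  | succ m =>
    have hpow : ∀ (k : ℕ) (hk : k < m + 1), v ⟨k, hk⟩ = μ⁻¹ ^ k * v 0 := by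
      intro k
      induction k with
      | zero => intro hk; simp
      | succ k ih =>
        intro hk
        have h1 := congrFun hμ ⟨k + 1, hk⟩
        rw [companion_mulVec_succ c v (j := ⟨k, by omega⟩) rfl, ih, Pi.smul_apply, smul_eq_mul] at h1
        rw [pow_succ', mul_assoc, h1]
        field_simp
    have hv0 : v 0 ≠ 0 := fun h0 => hv (funext fun i => by simpa [h0] using hpow i i.2)
    have h0 := congrFun hμ 0
    rw [companion_mulVec_zero c v rfl, Pi.smul_apply, smul_eq_mul] at h0
    refine h μ⁻¹ (by rw [norm_inv]; exact inv_le_one_of_one_le₀ hlt) ?_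
    have h1 : monicRev (m + 1) c μ⁻¹ * (μ * v 0) = 0 := by
      have h2 : ∀ j : Fin (m + 1), (c (j + 1) : ℂ) * μ⁻¹ ^ ((j : ℕ) + 1) * (μ * v 0) =
          (c (j + 1) : ℂ) * v j := fun j => by
        rw [hpow j j.2, pow_succ]
        field_simp
      rw [monicRev, add_mul, one_mul, Finset.sum_mul, Finset.sum_congr rfl fun j _ => h2 j, ← h0]
      simp
    exact (mul_eq_zero.1 h1).resolve_right (mul_ne_zero hμ0 hv0)

theorem zResolvent_companion {m : ℕ} {c : ℕ → ℝ} {z : ℂ} (hz : z ≠ 0)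
    (hspec : z ∉ spectrum ℂ (cplx (companion m c))) (h : monicRev m c z⁻¹ ≠ 0) (i : Fin m) :
    (zResolvent (companion m c) z * cplx (firstColumn m)) i 0 =
      z⁻¹ ^ ((i : ℕ) + 1) / monicRev m c z⁻¹ := by
  let x : Matrix (Fin m) (Fin 1) ℂ := .of fun i _ => z⁻¹ ^ ((i : ℕ) + 1) / monicRev m c z⁻¹
  have hx : (z • (1 : Matrix (Fin m) (Fin m) ℂ) - cplx (companion m c)) * x =
      cplx (firstColumn m) := by
    ext i j
    have h1 : ((z • (1 : Matrix (Fin m) (Fin m) ℂ) - cplx (companion m c)) * x) i j =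
        z * x i 0 - (cplx (companion m c) *ᵥ fun i => x i 0) i := by
      rw [Matrix.sub_mul, Matrix.smul_mul, Matrix.one_mul, Subsingleton.elim j 0]
      rfl
    rw [h1]
    rcases Nat.eq_zero_or_eq_succ_pred (i : ℕ) with hi | hi
    · rw [companion_mulVec_zero c _ hi]
      simp only [x, Matrix.of_apply, hi, zero_add, pow_one, sub_neg_eq_add, firstColumn, cplx_apply,
        if_true, mul_div_assoc', ← Finset.sum_div, ← add_div, mul_inv_cancel₀ hz, Complex.ofReal_one]
      exact div_self h
    · rw [companion_mulVec_succ c _ (j := ⟨(i : ℕ) - 1, by omega⟩) hi]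
      simp only [x, Matrix.of_apply, firstColumn, cplx_apply]
      rw [if_neg (by omega), hi, pow_succ z⁻¹ _]
      simp only [Nat.succ_eq_add_one, Nat.pred_eq_sub_one, Nat.add_sub_cancel]
      field_simp
      simp
  rw [← hx, ← Matrix.mul_assoc, zResolvent_mul_sub hspec, Matrix.one_mul]
  rfl

theorem exists_isFactorRealization {m : ℕ} {p q : ℕ → ℝ} {L : ℂ → ℂ}
    (hL : IsRationalSpectralFactor m p q L) :
    ∃ (At : Matrix (Fin m) (Fin m) ℝ) (Bt : Matrix (Fin m) (Fin 1) ℝ)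
      (Ct : Matrix (Fin 1) (Fin m) ℝ) (Dt : ℝ), IsFactorRealization L At Bt Ct Dt := by
  obtain ⟨a, b, ha, hb, ha0, hb0, hne, hLz⟩ := hL
  let α : ℕ → ℝ := fun i => a.coeff i / a.coeff 0
  let β : ℕ → ℝ := fun i => b.coeff i / b.coeff 0
  have ha' : ∀ ζ : ℂ, ‖ζ‖ ≤ 1 → monicRev m α ζ ≠ 0 := fun ζ hζ h0 =>
    (hne ζ hζ).1 (by rw [aeval_eq_monicRev ha ha0.ne', h0, mul_zero])
  have hb' : ∀ ζ : ℂ, ‖ζ‖ ≤ 1 → monicRev m β ζ ≠ 0 := fun ζ hζ h0 =>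
    (hne ζ hζ).2 (by rw [aeval_eq_monicRev hb hb0.ne', h0, mul_zero])
  -- Controllable canonical form of `L / L(∞)`; since `L(∞) = a₀ / b₀ > 0`, its square is `Dt`.
  refine ⟨companion m β, firstColumn m, coeffRow m β α,
    (a.coeff 0 / b.coeff 0) ^ 2, isSchur_companion hb', ?_, by positivity, fun z hz => ?_⟩
  · rw [companion_sub]
    exact isSchur_companion ha'
  · have hz0 : z ≠ 0 := by rintro rfl; simp at hz
    have hz' : ‖z⁻¹‖ ≤ 1 := by simp [hz]
    rw [(hLz z hz).1, aeval_eq_monicRev ha ha0.ne', aeval_eq_monicRev hb hb0.ne',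
      Real.sqrt_sq (by positivity), Matrix.mul_assoc, Matrix.mul_apply]
    simp only [zResolvent_companion hz0 ((isSchur_companion hb').notMem hz) (hb' _ hz'),
      cplx_apply, coeffRow, Matrix.of_apply, mul_div_assoc', ← Finset.sum_div,
      Complex.ofReal_sub, Complex.ofReal_div, sub_mul, Finset.sum_sub_distrib]
    have e1 : ∀ c : ℕ → ℝ, ∑ j : Fin m, (c (j + 1) : ℂ) * z⁻¹ ^ ((j : ℕ) + 1) =
        monicRev m c z⁻¹ - 1 := fun c => by rw [monicRev]; ring
    rw [e1, e1]
    have h1 := hb' _ hz'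
    have h2 : (b.coeff 0 : ℂ) ≠ 0 := by exact_mod_cast hb0.ne'
    change _ * monicRev m α z⁻¹ / (_ * monicRev m β z⁻¹) = _
    generalize monicRev m β z⁻¹ = y at *
    field_simp
    ring

end Companion

/-! ### Stable state-space models -/

section Signals

variable {ι σ : Type*} [Fintype σ]

theorem mulVec_abs_le {c : ℝ} (M : Matrix ι σ ℝ) {v : σ → ℝ} (hv : ∀ j, |v j| ≤ c) (i : ι) :
    |(M *ᵥ v) i| ≤ ∑ j, |M i j| * c := by
  refine (Finset.abs_sum_le_sum_abs _ _).trans (Finset.sum_le_sum fun j _ => ?_)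
  rw [abs_mul]
  exact mul_le_mul_of_nonneg_left (hv j) (abs_nonneg _)

theorem DRRO.IsBoundedSignal.mulVec [Finite ι] {w : ℤ → σ → ℝ} (hw : IsBoundedSignal w)
    (M : Matrix ι σ ℝ) : IsBoundedSignal fun t => M *ᵥ w t := by
  cases nonempty_fintype ι
  obtain ⟨c, hc⟩ := hw
  refine ⟨∑ i, ∑ j, |M i j| * |c|, fun t i => ?_⟩
  refine (mulVec_abs_le M (fun j => (hc t j).trans (le_abs_self c)) i).trans ?_
  exact Finset.single_le_sum (f := fun i => ∑ j, |M i j| * |c|)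
    (fun _ _ => Finset.sum_nonneg fun _ _ => by positivity) (Finset.mem_univ i)

theorem HasSum.matrix_mulVec {f : ℕ → σ → ℝ} {a : σ → ℝ} (h : HasSum f a) (M : Matrix ι σ ℝ) :
    HasSum (fun k => M *ᵥ f k) (M *ᵥ a) :=
  h.map M.mulVecLin (continuous_const.matrix_mulVec continuous_id)

end Signals

section StateSpace

variable {ι κ σ : Type*} [Fintype σ] [DecidableEq σ]

/-- The Markov parameters of `H (z I - F)⁻¹ G + J`. -/
def markov (F : Matrix σ σ ℝ) (G : Matrix σ κ ℝ) (H : Matrix ι σ ℝ) (J : Matrix ι κ ℝ) :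
    ℕ → Matrix ι κ ℝ
  | 0 => J
  | k + 1 => H * F ^ k * G

variable {F : Matrix σ σ ℝ} {G : Matrix σ κ ℝ} {H : Matrix ι σ ℝ} {J : Matrix ι κ ℝ}

theorem hasMarkovParameters_markov (hF : IsSchur F) {K : ℂ → Matrix ι κ ℂ}
    (hK : ∀ z : ℂ, ‖z‖ = 1 → K z = cplx H * zResolvent F z * cplx G + cplx J) :
    HasMarkovParameters K fun k => cplx (markov F G H J k) := by
  have hentry : ∀ (M : Matrix σ σ ℂ) i j, (cplx H * M * cplx G) i j =
      ∑ b, ∑ a, (H i a * G b j : ℂ) * M a b := fun M i j => by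
    simp only [Matrix.mul_apply, Finset.sum_mul, cplx_apply]
    exact Finset.sum_congr rfl fun b _ => Finset.sum_congr rfl fun a _ => by ring
  refine ⟨fun i j => ?_, fun z hz i j => ?_⟩
  · rw [← summable_nat_add_iff 1]
    simp only [markov, cplx_mul, cplx_pow, hentry]
    refine (summable_sum (s := Finset.univ) fun b _ => summable_sum (s := Finset.univ) fun a _ =>
      (hF.summable_pow a b).mul_left ‖(H i a * G b j : ℂ)‖).of_nonneg_of_le
      (fun _ => norm_nonneg _) fun k => ?_
    refine (norm_sum_le _ _).trans (Finset.sum_le_sum fun b _ => (norm_sum_le _ _).trans_eq ?_)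
    simp only [norm_mul]
  · rw [← hasSum_nat_add_iff' 1, hK z hz]
    simp only [markov, cplx_mul, cplx_pow, Finset.sum_range_one, pow_zero, mul_one,
      Matrix.add_apply, add_sub_cancel_right, hentry, Finset.sum_mul, mul_assoc]
    exact hasSum_sum fun b _ => hasSum_sum fun a _ =>
      ((hF.hasSum_zResolvent hz a b).mul_left _).mul_left _

/-- Cramer's rule over `ℝ[X]`: the resolvent is the adjugate of the characteristic matrix over the
characteristic polynomial, which has no zero on the circle. -/
theorem isRational_of_eq (hF : IsSchur F) {K : ℂ → Matrix ι κ ℂ}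
    (hK : ∀ z : ℂ, ‖z‖ = 1 → K z = cplx H * zResolvent F z * cplx G + cplx J) :
    IsRational K := by
  refine ⟨H.map Polynomial.C * F.charmatrix.adjugate * G.map Polynomial.C +
    F.charpoly • J.map Polynomial.C, F.charpoly, fun z hz => ?_⟩
  let f : ℝ[X] →+* ℂ := (Polynomial.aeval z : ℝ[X] →ₐ[ℝ] ℂ).toRingHom
  have hf : ∀ x, Polynomial.aeval z x = f x := fun _ => rfl
  have hfC : ∀ x : ℝ, f (Polynomial.C x) = x := fun x => by simp [f]
  have h1 : f.mapMatrix F.charmatrix = z • (1 : Matrix σ σ ℂ) - cplx F := by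
    ext i j
    by_cases hij : i = j
    · subst hij; simp [Matrix.charmatrix, f]
    · simp [Matrix.charmatrix, hij, hfC]
  have h2 : f F.charpoly = (z • (1 : Matrix σ σ ℂ) - cplx F).det := by
    rw [Matrix.charpoly, RingHom.map_det, h1]
  have h3 : (z • (1 : Matrix σ σ ℂ) - cplx F).det ≠ 0 :=
    ((Matrix.isUnit_iff_isUnit_det _).1 (isUnit_sub_of_notMem_spectrum (hF.notMem hz))).ne_zero
  have h4 : F.charmatrix.adjugate.map f = (z • (1 : Matrix σ σ ℂ) - cplx F).adjugate := by
    rw [← h1, ← RingHom.map_adjugate]; rfl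
  have hN : (H.map Polynomial.C * F.charmatrix.adjugate * G.map Polynomial.C +
      F.charpoly • J.map Polynomial.C).map f =
        (z • (1 : Matrix σ σ ℂ) - cplx F).det • K z := by
    rw [hK z hz, zResolvent, Matrix.inv_def, Ring.inverse_eq_inv', Matrix.mul_smul,
      Matrix.smul_mul, smul_add, smul_smul, mul_inv_cancel₀ h3, one_smul, ← h4, ← h2]
    have hH : (H.map Polynomial.C).map f = cplx H := by ext; simp [hfC]
    have hG : (G.map Polynomial.C).map f = cplx G := by ext; simp [hfC]
    rw [Matrix.map_add f (map_add f), Matrix.map_mul, Matrix.map_mul, hH, hG]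
    congr 1
    ext i j
    simp [hfC]
  refine ⟨by rw [hf, h2]; exact h3, fun i j => ?_⟩
  have := congrFun (congrFun hN i) j
  rw [Matrix.map_apply, Matrix.smul_apply, smul_eq_mul] at this
  rw [hf, hf, this, h2, mul_div_cancel_left₀ _ h3]

/-- Variation of constants from time `-∞`: the state is the sum of all past inputs propagated by
powers of `F`. -/
theorem exists_bounded_trajectory (hF : IsSchur F) {g : ℤ → σ → ℝ} (hg : IsBoundedSignal g) :
    ∃ e : ℤ → σ → ℝ, IsBoundedSignal e ∧ (∀ t, e (t + 1) = F *ᵥ e t + g t) ∧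
      ∀ t : ℤ, HasSum (fun k : ℕ => F ^ k *ᵥ g (t - (k + 1))) (e t) := by
  obtain ⟨c, hc⟩ := hg
  have hS : ∀ i, Summable fun k : ℕ => ∑ j, |(F ^ k) i j| * c := fun i =>
    summable_sum fun j _ => (hF.summable_pow_real i j).mul_right c
  have hle : ∀ (t : ℤ) i (k : ℕ), ‖(F ^ k *ᵥ g (t - (k + 1))) i‖ ≤ ∑ j, |(F ^ k) i j| * c :=
    fun t i k => mulVec_abs_le _ (hc _) i
  have hs : ∀ t : ℤ, Summable fun k : ℕ => F ^ k *ᵥ g (t - (k + 1)) := fun t =>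
    Pi.summable.2 fun i => (hS i).of_norm_bounded (hle t i)
  refine ⟨fun t => ∑' k : ℕ, F ^ k *ᵥ g (t - (k + 1)), ?_, fun t => ?_, fun t => (hs t).hasSum⟩
  · refine ⟨∑ i, ∑' k : ℕ, ∑ j, |(F ^ k) i j| * |c|, fun t i => ?_⟩
    have h1 : |(∑' k : ℕ, F ^ k *ᵥ g (t - (k + 1))) i| ≤ ∑' k : ℕ, ∑ j, |(F ^ k) i j| * c := by
      rw [tsum_apply (hs t)]
      exact tsum_of_norm_bounded (hS i).hasSum (hle t i)
    have h2 : ∀ i, Summable fun k : ℕ => ∑ j, |(F ^ k) i j| * |c| := fun i =>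
      summable_sum fun j _ => (hF.summable_pow_real i j).mul_right |c|
    refine h1.trans (((hS i).tsum_le_tsum (fun k => Finset.sum_le_sum fun j _ => ?_) (h2 i)).trans ?_)
    · exact mul_le_mul_of_nonneg_left (le_abs_self c) (abs_nonneg _)
    · exact Finset.single_le_sum (f := fun i => ∑' k : ℕ, ∑ j, |(F ^ k) i j| * |c|)
        (fun _ _ => tsum_nonneg fun _ => Finset.sum_nonneg fun _ _ => by positivity)
        (Finset.mem_univ i)
  · have h1 := (hasSum_nat_add_iff' 1).2 (hs (t + 1)).hasSum
    have h2 := (hs t).hasSum.matrix_mulVec F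
    simp only [Matrix.mulVec_mulVec, ← pow_succ'] at h2
    have h4 : ∀ k : ℕ, t + 1 - ((k + 1 : ℕ) + 1) = t - ((k : ℤ) + 1) := fun k => by
      push_cast; ring
    simp only [h4] at h1
    have h3 := h1.unique h2
    simpa [sub_eq_iff_eq_add] using h3

/-- Going back in time, `d t = F ^ k d (t - k)`: decaying powers times bounded vectors. -/
theorem eq_zero_of_bounded_trajectory (hF : IsSchur F) {d : ℤ → σ → ℝ} (hd : IsBoundedSignal d)
    (h : ∀ t, d (t + 1) = F *ᵥ d t) : d = 0 := by
  obtain ⟨c, hc⟩ := hd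
  have hpow : ∀ (k : ℕ) (t : ℤ), d t = F ^ k *ᵥ d (t - k) := by
    intro k
    induction k with
    | zero => intro t; simp
    | succ k ih =>
      intro t
      have := h (t - (k + 1))
      rw [show t - ((k : ℤ) + 1) + 1 = t - k by ring] at this
      rw [ih t, this, Matrix.mulVec_mulVec, ← pow_succ]
      push_cast
      rfl
  ext t i
  have h1 : Filter.Tendsto (fun k : ℕ => ∑ j, |(F ^ k) i j| * c) Filter.atTop (nhds 0) :=
    (summable_sum fun j _ => (hF.summable_pow_real i j).mul_right c).tendsto_atTop_zero
  refine abs_nonpos_iff.1 (ge_of_tendsto' h1 fun k => ?_)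
  conv_lhs => rw [hpow k t]
  exact mulVec_abs_le _ (hc _) i

theorem isRealizedBy_markov [Fintype κ] (hF : IsSchur F) : IsRealizedBy (markov F G H J) F G H J := by
  intro w hw
  obtain ⟨e, he, hrec, hsum⟩ := exists_bounded_trajectory hF (hw.mulVec G)
  have huniq : ∀ e', IsStateTrajectory F G w e' → e' = e := fun e' he' => by
    refine sub_eq_zero.1 (eq_zero_of_bounded_trajectory hF ?_ fun t => ?_)
    · obtain ⟨c, hc⟩ := he
      obtain ⟨c', hc'⟩ := he'.1
      exact ⟨c' + c, fun t i => (abs_sub _ _).trans (add_le_add (hc' t i) (hc t i))⟩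
    · rw [Pi.sub_apply, Pi.sub_apply, he'.2, hrec, Matrix.mulVec_sub]
      abel
  refine ⟨⟨e, ⟨he, hrec⟩, huniq⟩, fun e' he' t => ?_⟩
  rw [huniq e' he', ← hasSum_nat_add_iff' 1]
  have := (hsum t).matrix_mulVec H
  simpa [markov, Matrix.mulVec_mulVec, Matrix.mul_assoc] using this

end StateSpace

/-! ### Uniqueness of the controller -/

section Uniqueness

variable {dx du ds : ℕ} {A : Matrix (Fin dx) (Fin dx) ℝ} {Bu : Matrix (Fin dx) (Fin du) ℝ}
  {C : Matrix (Fin ds) (Fin dx) ℝ}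

theorem DRRO.IsStabilizingLaw.sub {d : ℕ} {B : Matrix (Fin dx) (Fin d) ℝ}
    {V V' : ℂ → Matrix (Fin du) (Fin d) ℂ} (h : IsStabilizingLaw A Bu B V)
    (h' : IsStabilizingLaw A Bu B V') : IsStabilizingLaw A Bu 0 fun z => V z - V' z := by
  obtain ⟨hV, X, hX, hs⟩ := h
  obtain ⟨hV', X', hX', hs'⟩ := h'
  refine ⟨isCausal_iff.2 ((isCausal_iff.1 hV).sub (isCausal_iff.1 hV')), fun z => X z - X' z,
    isCausal_iff.2 ((isCausal_iff.1 hX).sub (isCausal_iff.1 hX')), fun z hz => ?_⟩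
  rw [Matrix.mul_sub, Matrix.mul_sub, hs z hz, hs' z hz, cplx_zero]
  abel

/-- At regular points `V` and `V'` are the inverses of `Δ` and `Δ'`. Then `Y = Δ Δ'⁻¹` is causal,
and so is its inverse `Y' = Δ' Δ⁻¹`. As both factors have the same spectrum `Y` is unitary, so `Y' =
Y*`, and a causal function with causal adjoint is constant. -/
theorem DRRO.IsCanonicalFactor.exists_const_mul {Δ Δ' : ℂ → Matrix (Fin du) (Fin du) ℂ}
    (h : IsCanonicalFactor A Bu C Δ) (h' : IsCanonicalFactor A Bu C Δ') :
    ∃ M : Matrix (Fin du) (Fin du) ℂ, ∀ z, IsRegularPoint A z → Δ z = M * Δ' z := by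
  obtain ⟨hfac, hmaps, V, hV, hVinv⟩ := h
  obtain ⟨hfac', hmaps', V', hV', hVinv'⟩ := h'
  obtain ⟨Y, hY, hYeq⟩ := hmaps _ V' hV'
  obtain ⟨Y', hY', hYeq'⟩ := hmaps' _ V hV
  have hinv : ∀ z, IsRegularPoint A z → Y z * Δ' z = Δ z := fun z hz => by
    rw [← hYeq z hz, Matrix.mul_assoc, mul_eq_one_comm.1 (hVinv' z hz), Matrix.mul_one]
  have hadj : ∀ z : ℂ, ‖z‖ = 1 → z ∉ spectrum ℂ (cplx A) → Y' z = (Y z)ᴴ := fun z hz hzs => by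
    have hr : IsRegularPoint A z := ⟨hz, hzs⟩
    have h1 : Y z * Y' z = 1 := by
      rw [← hYeq' z hr, ← Matrix.mul_assoc, hinv z hr, hVinv z hr]
    have h2 : (Y z)ᴴ * Y z = 1 := by
      rw [← hYeq z hr, Matrix.conjTranspose_mul, Matrix.mul_assoc, ← Matrix.mul_assoc (Δ z)ᴴ,
        hfac z hr, ← hfac' z hr, Matrix.mul_assoc, hVinv' z hr, Matrix.mul_one,
        ← Matrix.conjTranspose_mul, hVinv' z hr, Matrix.conjTranspose_one]
    rw [← Matrix.one_mul (Y' z), ← h2, Matrix.mul_assoc, h1, Matrix.mul_one]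
  obtain ⟨M, hM⟩ := eq_const_of_causal_of_causal_conjTranspose (isCausal_iff.1 hY)
    (isCausal_iff.1 hY') (Matrix.finite_spectrum _) hadj
  exact ⟨M, fun z hz => by rw [← hM z hz.1, hinv z hz]⟩

theorem DRRO.IsController.unique {Bw : Matrix (Fin dx) (Fin 1) ℝ} {L : ℂ → ℂ}
    {K K' : ℂ → Matrix (Fin du) (Fin 1) ℂ} (h : IsController A Bu Bw C L K)
    (h' : IsController A Bu Bw C L K') {z : ℂ} (hz : ‖z‖ = 1) : K z = K' z := by
  obtain ⟨hK, Δ, U, T, W, hΔ, ⟨hT, hsplit, V, hV, hU⟩, ⟨hW, Z, hZ, hWeq⟩, hKeq⟩ := h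
  obtain ⟨hK', Δ', U', T', W', hΔ', ⟨hT', hsplit', V', hV', hU'⟩, ⟨hW', Z', hZ', hWeq'⟩, hKeq'⟩ := h'
  obtain ⟨M, hM⟩ := hΔ.exists_const_mul hΔ'
  obtain ⟨Y, hY, hYeq⟩ := hΔ.2.1 _ _ (hV.sub hV')
  obtain ⟨-, -, V₁, -, hV₁⟩ := hΔ
  obtain ⟨-, -, V₂, -, hV₂⟩ := hΔ'
  rw [isCausal_iff] at hK hK' hY hW hW'
  rw [isStrictlyAnticausal_iff] at hT hT' hZ hZ'
  have hfin := Matrix.finite_spectrum (R := ℂ) (cplx A)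
  -- Subtracting the two splits gives `Δ (V - V') = M T' - T`. The left side is causal because `V -
  -- V'` is a stabilizing law for zero disturbance; the right side is strictly anticausal.
  have hT0 : ∀ w : ℂ, ‖w‖ = 1 → Y w = 0 ∧ M * T' w - T w = 0 := fun w hw =>
    eq_zero_of_causal_of_anticausal_off_finite hY ((hT'.mul_left M).sub hT) hfin
      (fun w hw hws => by
        have hr : IsRegularPoint A w := ⟨hw, hws⟩
        have h1 := hsplit w hr
        rw [hM w hr, Matrix.mul_assoc, hsplit' w hr, Matrix.mul_add, hU w hr, hU' w hr,
          ← Matrix.mul_assoc, ← hM w hr] at h1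
        rw [← hYeq w hr, Matrix.mul_sub, eq_comm, sub_eq_sub_iff_add_eq_add, add_comm, h1,
          add_comm]) hw
  -- With `T = M T'`, both `W` and `M W'` are causal parts of `L T`.
  have hW0 : ∀ w : ℂ, ‖w‖ = 1 → W w = M * W' w := fun w hw => by
    refine sub_eq_zero.1 (eq_zero_of_causal_of_anticausal (hW.sub (hW'.mul_left M))
      ((hZ'.mul_left M).sub hZ) (fun w hw => ?_) hw)
    have h1 : L w • T w = W w + Z w := hWeq w hw
    have h2 : L w • T' w = W' w + Z' w := hWeq' w hw
    rw [← sub_eq_zero.1 (hT0 w hw).2, ← Matrix.mul_smul, h2, Matrix.mul_add] at h1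
    rw [sub_eq_sub_iff_add_eq_add, ← h1, add_comm]
  refine eq_of_causal_of_causal hK hK' hfin (fun w hw hws => ?_) hz
  have hr : IsRegularPoint A w := ⟨hw, hws⟩
  have hd : IsUnit (Δ w).det := Matrix.isUnit_det_of_right_inverse (hV₁ w hr)
  have hd' : IsUnit (Δ' w).det := Matrix.isUnit_det_of_right_inverse (hV₂ w hr)
  have hVV : V w = V' w := by
    have h1 := hYeq w hr
    rw [(hT0 w hw).1] at h1
    have h2 := congrArg ((Δ w)⁻¹ * ·) h1
    simp only [← Matrix.mul_assoc, Matrix.nonsing_inv_mul _ hd, Matrix.one_mul,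
      Matrix.mul_zero] at h2
    exact sub_eq_zero.1 h2
  -- The constant `M` cancels in `Δ⁻¹ W = Δ⁻¹ M W' = Δ'⁻¹ W'`.
  have hinv : (Δ' w)⁻¹ = (Δ w)⁻¹ * M := by
    refine Matrix.inv_eq_left_inv ?_
    rw [Matrix.mul_assoc, ← hM w hr, Matrix.nonsing_inv_mul _ hd]
  rw [hKeq w hr, hKeq' w hr, hU w hr, hU' w hr, ← Matrix.mul_assoc, ← Matrix.mul_assoc,
    Matrix.nonsing_inv_mul _ hd, Matrix.nonsing_inv_mul _ hd', hVV, hW0 w hw, hinv,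
    Matrix.mul_assoc]

end Uniqueness

/-! ### Identities between resolvents -/

section ResolventIdentities

variable {ι κ l o : Type*} [Fintype ι] [DecidableEq ι] [Fintype κ]

theorem zResolvent_sub_eq {A A' : Matrix ι ι ℝ} {B : Matrix ι κ ℝ} {K : Matrix κ ι ℝ} {z : ℂ}
    (hA : z ∉ spectrum ℂ (cplx A)) (hA' : z ∉ spectrum ℂ (cplx A')) (h : A' = A - B * K) :
    zResolvent A z = zResolvent A' z + zResolvent A z * cplx B * cplx K * zResolvent A' z := by
  have h1 : z • (1 : Matrix ι ι ℂ) - cplx A' =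
      (z • (1 : Matrix ι ι ℂ) - cplx A) + cplx B * cplx K := by
    rw [h, cplx_sub, cplx_mul]; abel
  calc zResolvent A z = zResolvent A z * ((z • (1 : Matrix ι ι ℂ) - cplx A') * zResolvent A' z) := by
        rw [sub_mul_zResolvent hA', Matrix.mul_one]
    _ = zResolvent A z * (z • (1 : Matrix ι ι ℂ) - cplx A) * zResolvent A' z +
        zResolvent A z * cplx B * cplx K * zResolvent A' z := by
        rw [h1]; simp only [Matrix.add_mul, Matrix.mul_add, Matrix.mul_assoc]
    _ = _ := by rw [zResolvent_mul_sub hA, Matrix.one_mul]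

theorem zResolvent_sub_eq' {A A' : Matrix ι ι ℝ} {B : Matrix ι κ ℝ} {K : Matrix κ ι ℝ} {z : ℂ}
    (hA : z ∉ spectrum ℂ (cplx A)) (hA' : z ∉ spectrum ℂ (cplx A')) (h : A' = A - B * K) :
    zResolvent A z = zResolvent A' z + zResolvent A' z * cplx B * cplx K * zResolvent A z := by
  have h1 : A = A' - B * (-K) := by rw [h, Matrix.mul_neg, sub_neg_eq_add, sub_add_cancel]
  have := zResolvent_sub_eq hA' hA h1
  rw [cplx_neg, Matrix.mul_neg, Matrix.neg_mul, ← sub_eq_add_neg, eq_sub_iff_add_eq] at this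
  exact this.symm

theorem zResolvent_transpose_inv {A : Matrix ι ι ℝ} {z : ℂ} (hz : ‖z‖ = 1) :
    zResolvent Aᵀ z⁻¹ = (zResolvent A z)ᴴ := by
  rw [zResolvent, zResolvent, Matrix.conjTranspose_nonsing_inv, Matrix.conjTranspose_sub,
    Matrix.conjTranspose_smul, Matrix.conjTranspose_one, cplx_conjTranspose,
    Complex.inv_eq_conj hz]
  rfl

/-- The return difference and its inverse. -/
theorem returnDifference_mul [DecidableEq κ] {A A' : Matrix ι ι ℝ} {B : Matrix ι κ ℝ} {K : Matrix κ ι ℝ} {z : ℂ}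
    (hA : z ∉ spectrum ℂ (cplx A)) (hA' : z ∉ spectrum ℂ (cplx A')) (h : A' = A - B * K) :
    (1 + cplx K * zResolvent A z * cplx B) * (1 - cplx K * zResolvent A' z * cplx B) = 1 := by
  have h1 := congrArg (fun M => cplx K * M * cplx B) (zResolvent_sub_eq hA hA' h)
  simp only [Matrix.mul_add, Matrix.add_mul, Matrix.mul_assoc] at h1
  simp only [Matrix.mul_sub, Matrix.add_mul, Matrix.mul_assoc, Matrix.mul_one, Matrix.one_mul]
  rw [h1]
  abel

theorem zResolvent_mul_returnDifference [DecidableEq κ] {A A' : Matrix ι ι ℝ} {B : Matrix ι κ ℝ}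
    {K : Matrix κ ι ℝ} {z : ℂ}
    (hA : z ∉ spectrum ℂ (cplx A)) (hA' : z ∉ spectrum ℂ (cplx A')) (h : A' = A - B * K) :
    zResolvent A z * cplx B * (1 - cplx K * zResolvent A' z * cplx B) =
      zResolvent A' z * cplx B := by
  have h1 := congrArg (· * cplx B) (zResolvent_sub_eq hA hA' h)
  simp only [Matrix.add_mul, Matrix.mul_assoc] at h1
  simp only [Matrix.mul_sub, Matrix.mul_assoc, Matrix.mul_one]
  rw [sub_eq_iff_eq_add, ← h1]

theorem zResolvent_mul_returnDifference' [DecidableEq κ] {A A' : Matrix ι ι ℝ} {B : Matrix ι κ ℝ}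
    {K : Matrix κ ι ℝ} {z : ℂ}
    (hA : z ∉ spectrum ℂ (cplx A)) (hA' : z ∉ spectrum ℂ (cplx A')) (h : A' = A - B * K) :
    zResolvent A' z * cplx B * (1 + cplx K * zResolvent A z * cplx B) =
      zResolvent A z * cplx B := by
  conv_rhs => rw [zResolvent_sub_eq' hA hA' h]
  simp only [Matrix.mul_add, Matrix.add_mul, Matrix.mul_assoc, Matrix.mul_one]

/-- The resolvent form of the dissipation identity `c* c = p - a* p a + k* s k`. -/
theorem conjTranspose_mul_self_eq {a p φ : Matrix ι ι ℂ} {c : Matrix l ι ℂ} [Fintype l]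
    {k : Matrix κ ι ℂ} {s : Matrix κ κ ℂ} {z : ℂ} (hz : ‖z‖ = 1) (hφ : z • φ = 1 + a * φ)
    (hc : cᴴ * c = p - aᴴ * p * a + kᴴ * s * k) :
    φᴴ * (cᴴ * c) * φ = p + φᴴ * aᴴ * p + p * a * φ + φᴴ * kᴴ * s * k * φ := by
  -- On the circle `z` drops out of the quadratic form; expanding `zφ = 1 + aφ` then trades `φ* p φ`
  -- for terms without `z`.
  have h1 : (z • φ)ᴴ * p * (z • φ) = φᴴ * p * φ := by
    rw [Matrix.conjTranspose_smul, Matrix.smul_mul, Matrix.smul_mul, Matrix.mul_smul, smul_smul]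
    have : star z * z = 1 := by
      have := Complex.conj_mul' z
      rw [hz] at this
      simpa using this
    rw [this, one_smul]
  rw [hφ, Matrix.conjTranspose_add, Matrix.conjTranspose_one, Matrix.conjTranspose_mul] at h1
  rw [hc, Matrix.mul_add, Matrix.mul_sub, Matrix.add_mul, Matrix.sub_mul, ← h1]
  simp only [Matrix.mul_add, Matrix.add_mul, Matrix.mul_assoc, Matrix.mul_one, Matrix.one_mul]
  abel

end ResolventIdentities

/-! ### The canonical factor given by the Riccati equation -/

section CanonicalFactor

variable {dx du ds : ℕ} {A : Matrix (Fin dx) (Fin dx) ℝ} {Bu : Matrix (Fin dx) (Fin du) ℝ}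
  {C : Matrix (Fin ds) (Fin dx) ℝ} {P : Matrix (Fin dx) (Fin dx) ℝ}

/-- `I + K_lqr (z I - A)⁻¹ B_u`. -/
noncomputable def returnDiff (A : Matrix (Fin dx) (Fin dx) ℝ) (Bu : Matrix (Fin dx) (Fin du) ℝ)
    (P : Matrix (Fin dx) (Fin dx) ℝ) (z : ℂ) : Matrix (Fin du) (Fin du) ℂ :=
  1 + cplx (lqrGain A Bu P) * zResolvent A z * cplx Bu

/-- `I - K_lqr (z I - A_k)⁻¹ B_u`. -/
noncomputable def returnDiffInv (A : Matrix (Fin dx) (Fin dx) ℝ) (Bu : Matrix (Fin dx) (Fin du) ℝ)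
    (P : Matrix (Fin dx) (Fin dx) ℝ) (z : ℂ) : Matrix (Fin du) (Fin du) ℂ :=
  1 - cplx (lqrGain A Bu P) * zResolvent (closedLoop A Bu P) z * cplx Bu

/-- Solving the state equation for `X` trades `Φ B_u V` for the stable state `X`. For `B = 0` no
open-loop resolvent is left on the right, so causality is visible even if `A` is unstable. -/
theorem returnDiff_mul_law {d : ℕ} {B : Matrix (Fin dx) (Fin d) ℝ} {z : ℂ}
    (hz : IsRegularPoint A z) {V : Matrix (Fin du) (Fin d) ℂ} {X : Matrix (Fin dx) (Fin d) ℂ}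
    (h : (z • (1 : Matrix (Fin dx) (Fin dx) ℂ) - cplx A) * X = cplx Bu * V + cplx B) :
    returnDiff A Bu P z * V =
      V + cplx (lqrGain A Bu P) * X - cplx (lqrGain A Bu P) * zResolvent A z * cplx B := by
  have h1 := congrArg (zResolvent A z * ·) h
  simp only [← Matrix.mul_assoc, zResolvent_mul_sub hz.2, Matrix.one_mul, Matrix.mul_add] at h1
  rw [h1, returnDiff]
  simp only [Matrix.add_mul, Matrix.mul_add, Matrix.one_mul, Matrix.mul_assoc]
  abel

namespace DRRO.IsStabilizingRiccati

theorem notMem (hP : IsStabilizingRiccati A Bu C P) {z : ℂ} (hz : ‖z‖ = 1) : z ∉ spectrum ℂ (cplx (closedLoop A Bu P)) :=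
  hP.2.2.2.notMem hz

theorem returnDiff_mul (hP : IsStabilizingRiccati A Bu C P) {z : ℂ} (hz : IsRegularPoint A z) :
    returnDiff A Bu P z * returnDiffInv A Bu P z = 1 :=
  returnDifference_mul hz.2 (hP.notMem hz.1) rfl

theorem returnDiffInv_mul (hP : IsStabilizingRiccati A Bu C P) {z : ℂ} (hz : IsRegularPoint A z) :
    returnDiffInv A Bu P z * returnDiff A Bu P z = 1 :=
  mul_eq_one_comm.1 (hP.returnDiff_mul hz)

/-- `F* G = (I + K Φ B_u)* S K Φ B + B_u* (I + Φ* A*) P B` with `Φ = (z I - A)⁻¹` and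
`S = I + B_u* P B_u`. -/
theorem plantTF_conjTranspose_mul (hP : IsStabilizingRiccati A Bu C P) {d : ℕ} {z : ℂ}
    (hz : IsRegularPoint A z)
    (B : Matrix (Fin dx) (Fin d) ℝ) :
    (plantTF A C Bu z)ᴴ * plantTF A C B z =
      (returnDiff A Bu P z)ᴴ * cplx (1 + Buᵀ * P * Bu) * cplx (lqrGain A Bu P) * zResolvent A z *
        cplx B + cplx Buᵀ * (1 + (zResolvent A z)ᴴ * cplx Aᵀ) * cplx P * cplx B := by
  have hc : (cplx C)ᴴ * cplx C = cplx P - (cplx A)ᴴ * cplx P * cplx A +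
      (cplx (lqrGain A Bu P))ᴴ * cplx (1 + Buᵀ * P * Bu) * cplx (lqrGain A Bu P) := by
    simp only [cplx_conjTranspose, ← cplx_mul, ← cplx_sub, ← cplx_add]
    congr 1
    have h1 := hP.eq_add
    rw [closedLoop, Matrix.mul_sub, ← Matrix.mul_assoc, ← lqrGain_transpose_mul hP.1 hP.2.1] at h1
    rw [eq_comm, sub_add, sub_eq_iff_eq_add]
    exact h1
  have h1 := conjTranspose_mul_self_eq hz.1 (smul_zResolvent hz.2) hc
  have h2 : (plantTF A C Bu z)ᴴ * plantTF A C B z = (cplx Bu)ᴴ *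
      ((zResolvent A z)ᴴ * ((cplx C)ᴴ * cplx C) * zResolvent A z) * cplx B := by
    simp only [plantTF, Matrix.conjTranspose_mul, Matrix.mul_assoc]
  have h3 : cplx Buᵀ * cplx P * cplx A =
      cplx (1 + Buᵀ * P * Bu) * cplx (lqrGain A Bu P) := by
    simp only [← cplx_mul, mul_lqrGain hP.2.1]
  rw [h2, h1, returnDiff]
  simp only [Matrix.conjTranspose_add, Matrix.conjTranspose_mul, Matrix.conjTranspose_one,
    cplx_conjTranspose, Matrix.mul_add, Matrix.add_mul, Matrix.one_mul, Matrix.mul_one]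
  rw [← h3]
  simp only [Matrix.mul_assoc]
  abel

/-- The case `B = B_u` of the previous identity: since `A* P B_u = K_lqrᵀ S`, its second term plus
`1` is `(I + K_lqr Φ B_u)* S`. -/
theorem one_add_plantTF (hP : IsStabilizingRiccati A Bu C P) {z : ℂ} (hz : IsRegularPoint A z) :
    1 + (plantTF A C Bu z)ᴴ * plantTF A C Bu z =
      (returnDiff A Bu P z)ᴴ * cplx (1 + Buᵀ * P * Bu) * returnDiff A Bu P z := by
  have h1 : cplx Aᵀ * cplx P * cplx Bu =
      cplx (lqrGain A Bu P)ᵀ * cplx (1 + Buᵀ * P * Bu) := by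
    simp only [← cplx_mul, lqrGain_transpose_mul hP.1 hP.2.1]
  have h2 : (returnDiff A Bu P z)ᴴ * cplx (1 + Buᵀ * P * Bu) =
      1 + cplx Buᵀ * (1 + (zResolvent A z)ᴴ * cplx Aᵀ) * cplx P * cplx Bu := by
    have h3 : cplx Buᵀ * (1 + (zResolvent A z)ᴴ * cplx Aᵀ) * cplx P * cplx Bu =
        cplx Buᵀ * cplx P * cplx Bu + cplx Buᵀ * (zResolvent A z)ᴴ *
          (cplx Aᵀ * cplx P * cplx Bu) := by
      simp only [Matrix.mul_add, Matrix.add_mul, Matrix.mul_one, Matrix.mul_assoc]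
    rw [h3, h1, returnDiff]
    simp only [Matrix.conjTranspose_add, Matrix.conjTranspose_mul, Matrix.conjTranspose_one,
      cplx_conjTranspose, Matrix.add_mul, Matrix.one_mul]
    conv_lhs => enter [1]; rw [cplx_add, cplx_one, cplx_mul, cplx_mul]
    simp only [Matrix.mul_assoc]
    abel
  rw [hP.plantTF_conjTranspose_mul hz, add_left_comm, ← h2]
  conv_rhs => rw [returnDiff.eq_def A Bu P z, Matrix.mul_add, Matrix.mul_one]
  rw [add_comm]
  simp only [returnDiff, Matrix.mul_assoc]

end DRRO.IsStabilizingRiccati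

end CanonicalFactor

/-! ### Causal and anticausal parts of `Δ K_∘` for the Riccati factor -/

section Factor

variable {dx du ds : ℕ} {A : Matrix (Fin dx) (Fin dx) ℝ} {Bu : Matrix (Fin dx) (Fin du) ℝ}
  {Bw : Matrix (Fin dx) (Fin 1) ℝ} {C : Matrix (Fin ds) (Fin dx) ℝ}
  {P : Matrix (Fin dx) (Fin dx) ℝ} {R : Matrix (Fin du) (Fin du) ℝ}

open scoped MatrixOrder in
theorem exists_transpose_mul_self_eq (hP : P.PosDef) :
    ∃ R : Matrix (Fin du) (Fin du) ℝ, Rᵀ * R = 1 + Buᵀ * P * Bu := by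
  have h := hP.posSemidef.conjTranspose_mul_mul_same Bu
  rw [Matrix.conjTranspose_eq_transpose_of_trivial] at h
  obtain ⟨R, hR⟩ := CStarAlgebra.nonneg_iff_eq_star_mul_self.mp
    (Matrix.PosDef.one.add_posSemidef h).posSemidef.nonneg
  exact ⟨R, by rw [hR, Matrix.star_eq_conjTranspose, Matrix.conjTranspose_eq_transpose_of_trivial]⟩

theorem sub_mul_zResolvent_closedLoop {z : ℂ}
    (hz : z ∉ spectrum ℂ (cplx (closedLoop A Bu P))) :
    (z • (1 : Matrix (Fin dx) (Fin dx) ℂ) - cplx A) * zResolvent (closedLoop A Bu P) z =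
      1 - cplx Bu * cplx (lqrGain A Bu P) * zResolvent (closedLoop A Bu P) z := by
  have h : z • (1 : Matrix (Fin dx) (Fin dx) ℂ) - cplx A =
      (z • (1 : Matrix (Fin dx) (Fin dx) ℂ) - cplx (closedLoop A Bu P)) -
        cplx Bu * cplx (lqrGain A Bu P) := by
    rw [closedLoop, cplx_sub, cplx_mul]; abel
  rw [h, Matrix.sub_mul, sub_mul_zResolvent hz]

/-- The canonical factor `R (I + K_lqr (z I - A)⁻¹ B_u)`. -/
noncomputable def riccatiFactor (A : Matrix (Fin dx) (Fin dx) ℝ) (Bu : Matrix (Fin dx) (Fin du) ℝ)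
    (P : Matrix (Fin dx) (Fin dx) ℝ) (R : Matrix (Fin du) (Fin du) ℝ) (z : ℂ) :
    Matrix (Fin du) (Fin du) ℂ :=
  cplx R * returnDiff A Bu P z

/-- The feedthrough `(I + B_u* P B_u)⁻¹ B_u* P B_w` of the `H₂` controller. -/
noncomputable def feedthrough (Bu : Matrix (Fin dx) (Fin du) ℝ) (Bw : Matrix (Fin dx) (Fin 1) ℝ)
    (P : Matrix (Fin dx) (Fin dx) ℝ) : Matrix (Fin du) (Fin 1) ℝ :=
  gainInv Bu P * Buᵀ * P * Bw

/-- The state of the plant under the `H₂` controller. -/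
noncomputable def h2State (A : Matrix (Fin dx) (Fin dx) ℝ) (Bu : Matrix (Fin dx) (Fin du) ℝ)
    (Bw : Matrix (Fin dx) (Fin 1) ℝ) (P : Matrix (Fin dx) (Fin dx) ℝ) (z : ℂ) :
    Matrix (Fin dx) (Fin 1) ℂ :=
  zResolvent (closedLoop A Bu P) z * cplx (Bw - Bu * feedthrough Bu Bw P)

/-- The `H₂` controller. -/
noncomputable def h2Law (A : Matrix (Fin dx) (Fin dx) ℝ) (Bu : Matrix (Fin dx) (Fin du) ℝ)
    (Bw : Matrix (Fin dx) (Fin 1) ℝ) (P : Matrix (Fin dx) (Fin dx) ℝ) (z : ℂ) :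
    Matrix (Fin du) (Fin 1) ℂ :=
  -(cplx (lqrGain A Bu P) * h2State A Bu Bw P z) - cplx (feedthrough Bu Bw P)

/-- The strictly anticausal part of `Δ K_∘`. -/
noncomputable def anticausalPart (A : Matrix (Fin dx) (Fin dx) ℝ) (Bu : Matrix (Fin dx) (Fin du) ℝ)
    (Bw : Matrix (Fin dx) (Fin 1) ℝ) (P : Matrix (Fin dx) (Fin dx) ℝ)
    (R : Matrix (Fin du) (Fin du) ℝ) (z : ℂ) : Matrix (Fin du) (Fin 1) ℂ :=
  -(cplx (R * gainInv Bu P * Buᵀ) * zResolvent (closedLoop A Bu P)ᵀ z⁻¹ *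
    cplx ((closedLoop A Bu P)ᵀ * P * Bw))

theorem isUnit_det_of_transpose_mul_self (hP : IsStabilizingRiccati A Bu C P)
    (hR : Rᵀ * R = 1 + Buᵀ * P * Bu) : IsUnit R.det := by
  have := hP.2.1
  rw [← hR, Matrix.det_mul] at this
  exact isUnit_of_mul_isUnit_right this

theorem cplx_mul_inv (hR : IsUnit R.det) : cplx R * cplx R⁻¹ = 1 := by
  rw [← cplx_mul, Matrix.mul_nonsing_inv _ hR, cplx_one]

theorem cplx_inv_mul (hR : IsUnit R.det) : cplx R⁻¹ * cplx R = 1 := by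
  rw [← cplx_mul, Matrix.nonsing_inv_mul _ hR, cplx_one]

theorem riccatiFactor_inv (hP : IsStabilizingRiccati A Bu C P) (hR : IsUnit R.det) {z : ℂ}
    (hz : IsRegularPoint A z) :
    (riccatiFactor A Bu P R z)⁻¹ = returnDiffInv A Bu P z * cplx R⁻¹ := by
  refine Matrix.inv_eq_left_inv ?_
  rw [riccatiFactor, Matrix.mul_assoc, ← Matrix.mul_assoc (cplx R⁻¹), cplx_inv_mul hR,
    Matrix.one_mul, hP.returnDiffInv_mul hz]

/-- On a law with state `X` the factor acts as `V ↦ R (V + K_lqr X)`; its inverse is the input of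
the loop closed by `K_lqr`, with state `Φ_k B_u R⁻¹`. -/
theorem isCanonicalFactor_riccatiFactor (hP : IsStabilizingRiccati A Bu C P)
    (hR : Rᵀ * R = 1 + Buᵀ * P * Bu) : IsCanonicalFactor A Bu C (riccatiFactor A Bu P R) := by
  have hRu := isUnit_det_of_transpose_mul_self hP hR
  have hΦ := hP.2.2.2.isAbsSeries_zResolvent
  refine ⟨fun z hz => ?_, fun d V hV => ?_, fun z => returnDiffInv A Bu P z * cplx R⁻¹,
    ⟨isCausal_iff.2 ?_, fun z => zResolvent (closedLoop A Bu P) z * (cplx Bu * cplx R⁻¹),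
      isCausal_iff.2 (hΦ.mul_right _), fun z hz => ?_⟩, fun z hz => ?_⟩
  · rw [hP.one_add_plantTF hz, ← hR, cplx_mul, riccatiFactor, Matrix.conjTranspose_mul,
      cplx_conjTranspose]
    simp only [Matrix.mul_assoc]
  · obtain ⟨hVc, X, hX, hs⟩ := hV
    rw [isCausal_iff] at hVc hX
    refine ⟨fun z => cplx R * (V z + cplx (lqrGain A Bu P) * X z),
      isCausal_iff.2 ((hVc.add (hX.mul_left _)).mul_left _), fun z hz => ?_⟩
    rw [riccatiFactor, Matrix.mul_assoc, returnDiff_mul_law hz (hs z hz.1), cplx_zero,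
      Matrix.mul_zero, sub_zero]
  · exact ((isAbsSeries_const 1).sub ((hΦ.mul_left _).mul_right _)).mul_right _
  · rw [← Matrix.mul_assoc, sub_mul_zResolvent_closedLoop (hP.notMem hz)]
    simp only [returnDiffInv, cplx_zero, Matrix.mul_sub, Matrix.sub_mul, Matrix.one_mul,
      Matrix.mul_assoc, add_zero]
  · rw [riccatiFactor, Matrix.mul_assoc, ← Matrix.mul_assoc (returnDiff A Bu P z),
      hP.returnDiff_mul hz, Matrix.one_mul, cplx_mul_inv hRu]

theorem isStabilizingLaw_h2Law (hP : IsStabilizingRiccati A Bu C P) :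
    IsStabilizingLaw A Bu Bw (h2Law A Bu Bw P) ∧ ∀ z : ℂ, ‖z‖ = 1 →
      (z • (1 : Matrix (Fin dx) (Fin dx) ℂ) - cplx A) * h2State A Bu Bw P z =
        cplx Bu * h2Law A Bu Bw P z + cplx Bw := by
  have hX : IsAbsSeries causalBasis (h2State A Bu Bw P) :=
    hP.2.2.2.isAbsSeries_zResolvent.mul_right _
  have hs : ∀ z : ℂ, ‖z‖ = 1 →
      (z • (1 : Matrix (Fin dx) (Fin dx) ℂ) - cplx A) * h2State A Bu Bw P z =
        cplx Bu * h2Law A Bu Bw P z + cplx Bw := fun z hz => by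
    rw [h2Law, h2State, ← Matrix.mul_assoc, sub_mul_zResolvent_closedLoop (hP.notMem hz)]
    simp only [Matrix.mul_sub, Matrix.sub_mul, Matrix.one_mul, Matrix.mul_neg, Matrix.mul_assoc,
      cplx_sub, cplx_mul]
    abel
  exact ⟨⟨isCausal_iff.2 ((hX.mul_left _).neg.sub (isAbsSeries_const _)), _, isCausal_iff.2 hX, hs⟩,
    hs⟩

/-- Inserting the factorization leaves `Δ K_∘ = -R S⁻¹ (I - K_lqr Φ_k B_u)* F*G`. The first term of
`F*G` contributes `-R K_lqr Φ B_w`, the second `-R S⁻¹ B_u* (I + Φ_k* A_k*) P B_w`. The constant of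
the latter is the feedthrough of the `H₂` law, and its remainder is the anticausal part. -/
theorem riccatiFactor_mul_noncausalPolicy (hP : IsStabilizingRiccati A Bu C P) {z : ℂ}
    (hz : IsRegularPoint A z) :
    riccatiFactor A Bu P R z * noncausalPolicy A Bu Bw C z =
      riccatiFactor A Bu P R z * h2Law A Bu Bw P z + anticausalPart A Bu Bw P R z := by
  have hmi := hP.returnDiff_mul hz
  have him := hP.returnDiffInv_mul hz
  have hSi : cplx (1 + Buᵀ * P * Bu) * cplx (gainInv Bu P) = 1 := by
    rw [← cplx_mul, mul_gainInv hP.2.1, cplx_one]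
  have hSi' : cplx (gainInv Bu P) * cplx (1 + Buᵀ * P * Bu) = 1 := by
    rw [← cplx_mul, gainInv_mul hP.2.1, cplx_one]
  have hstar : (returnDiffInv A Bu P z)ᴴ * (returnDiff A Bu P z)ᴴ = 1 := by
    rw [← Matrix.conjTranspose_mul, hmi, Matrix.conjTranspose_one]
  have hstar' : (returnDiff A Bu P z)ᴴ * (returnDiffInv A Bu P z)ᴴ = 1 := by
    rw [← Matrix.conjTranspose_mul, him, Matrix.conjTranspose_one]
  have hinv : (1 + (plantTF A C Bu z)ᴴ * plantTF A C Bu z)⁻¹ =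
      returnDiffInv A Bu P z * cplx (gainInv Bu P) * (returnDiffInv A Bu P z)ᴴ := by
    rw [hP.one_add_plantTF hz]
    refine Matrix.inv_eq_right_inv ?_
    calc _ = (returnDiff A Bu P z)ᴴ * (cplx (1 + Buᵀ * P * Bu) *
          (returnDiff A Bu P z * returnDiffInv A Bu P z) * cplx (gainInv Bu P)) *
            (returnDiffInv A Bu P z)ᴴ := by simp only [Matrix.mul_assoc]
      _ = 1 := by rw [hmi, Matrix.mul_one, hSi, Matrix.mul_one, hstar']
  -- Adjoint of `zΦ B_u (I - K_lqr Φ_k B_u) = zΦ_k B_u`: the open-loop resolvent is replaced by the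
  -- stable one.
  have hadj : (returnDiffInv A Bu P z)ᴴ * (cplx Buᵀ * (1 + (zResolvent A z)ᴴ * cplx Aᵀ)) =
      cplx Buᵀ * (1 + zResolvent (closedLoop A Bu P)ᵀ z⁻¹ * cplx (closedLoop A Bu P)ᵀ) := by
    have e1 : 1 + (zResolvent A z)ᴴ * cplx Aᵀ = (z • zResolvent A z)ᴴ := by
      rw [smul_zResolvent hz.2, Matrix.conjTranspose_add, Matrix.conjTranspose_mul,
        Matrix.conjTranspose_one, cplx_conjTranspose]
    have e2 : 1 + zResolvent (closedLoop A Bu P)ᵀ z⁻¹ * cplx (closedLoop A Bu P)ᵀ =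
        (z • zResolvent (closedLoop A Bu P) z)ᴴ := by
      rw [smul_zResolvent (hP.notMem hz.1), Matrix.conjTranspose_add, Matrix.conjTranspose_mul,
        Matrix.conjTranspose_one, cplx_conjTranspose, zResolvent_transpose_inv hz.1]
    rw [e1, e2, ← cplx_conjTranspose, ← Matrix.conjTranspose_mul, ← Matrix.conjTranspose_mul,
      ← Matrix.conjTranspose_mul, Matrix.smul_mul, Matrix.smul_mul, Matrix.smul_mul, returnDiffInv,
      zResolvent_mul_returnDifference hz.2 (hP.notMem hz.1) rfl]
  have hFG : (returnDiffInv A Bu P z)ᴴ * ((plantTF A C Bu z)ᴴ * plantTF A C Bw z) =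
      cplx (1 + Buᵀ * P * Bu) * (cplx (lqrGain A Bu P) * zResolvent A z * cplx Bw) +
        cplx Buᵀ * (1 + zResolvent (closedLoop A Bu P)ᵀ z⁻¹ * cplx (closedLoop A Bu P)ᵀ) *
          (cplx P * cplx Bw) := by
    rw [hP.plantTF_conjTranspose_mul hz, ← hadj, Matrix.mul_add]
    congr 1
    · simp only [← Matrix.mul_assoc, hstar, Matrix.one_mul]
    · simp only [Matrix.mul_assoc]
  have hlaw := returnDiff_mul_law (P := P) hz ((isStabilizingLaw_h2Law (Bw := Bw) hP).2 z hz.1)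
  have hlaw' : returnDiff A Bu P z * h2Law A Bu Bw P z = -cplx (feedthrough Bu Bw P) -
      cplx (lqrGain A Bu P) * zResolvent A z * cplx Bw := by
    rw [hlaw, h2Law]; abel
  have hlhs : riccatiFactor A Bu P R z * noncausalPolicy A Bu Bw C z =
      -(cplx R * (cplx (gainInv Bu P) * ((returnDiffInv A Bu P z)ᴴ *
        ((plantTF A C Bu z)ᴴ * plantTF A C Bw z)))) := by
    rw [riccatiFactor, noncausalPolicy, hinv, Matrix.mul_neg]
    congr 1
    calc _ = cplx R * ((returnDiff A Bu P z * returnDiffInv A Bu P z) * (cplx (gainInv Bu P) *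
          ((returnDiffInv A Bu P z)ᴴ * ((plantTF A C Bu z)ᴴ * plantTF A C Bw z)))) := by
            simp only [Matrix.mul_assoc]
      _ = _ := by rw [hmi, Matrix.one_mul]
  rw [hlhs, hFG, riccatiFactor, Matrix.mul_assoc (cplx R), hlaw', anticausalPart, Matrix.mul_add,
    ← Matrix.mul_assoc (cplx (gainInv Bu P)), hSi', Matrix.one_mul, feedthrough]
  simp only [Matrix.mul_add, Matrix.add_mul, Matrix.mul_sub, Matrix.mul_neg, Matrix.mul_assoc,
    Matrix.one_mul, cplx_mul]
  abel

theorem isPlantSplit_riccatiFactor (hP : IsStabilizingRiccati A Bu C P) :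
    IsPlantSplit A Bu Bw C (riccatiFactor A Bu P R)
      (fun z => riccatiFactor A Bu P R z * h2Law A Bu Bw P z) (anticausalPart A Bu Bw P R) :=
  ⟨isStrictlyAnticausal_iff.2
      ((hP.2.2.2.transpose.isAbsSeries_zResolvent_inv.mul_left _).mul_right _).neg,
    fun _ hz => riccatiFactor_mul_noncausalPolicy hP hz, h2Law A Bu Bw P,
    (isStabilizingLaw_h2Law hP).1, fun _ _ => rfl⟩

end Factor

/-! ### The state-space controller -/

section Realization

theorem mul_fin_one {ι : Type*} (X : Matrix ι (Fin 1) ℂ) (Y : Matrix (Fin 1) (Fin 1) ℂ) :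
    X * Y = Y 0 0 • X := by
  ext i j
  rw [Subsingleton.elim j 0]
  simp [Matrix.mul_apply, mul_comm]

/-- A product of an anticausal and a causal resolvent is split by the Stein equation. -/
theorem zResolvent_inv_mul_mul_zResolvent {ι κ : Type*} [Fintype ι] [DecidableEq ι] [Fintype κ]
    [DecidableEq κ] {M : Matrix ι ι ℝ} {N : Matrix κ κ ℝ} {Q U : Matrix ι κ ℝ} {z : ℂ}
    (hz : z ≠ 0) (hM : z⁻¹ ∉ spectrum ℂ (cplx M)) (hN : z ∉ spectrum ℂ (cplx N))
    (h : Q + M * U * N = U) :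
    zResolvent M z⁻¹ * cplx Q * zResolvent N z =
      zResolvent M z⁻¹ * cplx M * cplx U + cplx U * (z • zResolvent N z) := by
  have h1 : cplx Q = cplx U - cplx M * cplx U * cplx N := by
    rw [← cplx_mul, ← cplx_mul, ← cplx_sub]
    exact congrArg cplx (eq_sub_iff_add_eq.2 h)
  have h2 := smul_zResolvent hN
  have h3 := smul_zResolvent' hM
  have h4 : zResolvent M z⁻¹ = z • (1 + zResolvent M z⁻¹ * cplx M) := by
    rw [← h3, smul_smul, mul_inv_cancel₀ hz, one_smul]
  -- The factor `z` from the reflected resolvent turns the other one into `z (zI - N)⁻¹ = I + N (zI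
  -- - N)⁻¹`.
  have h5 : zResolvent M z⁻¹ * cplx U * zResolvent N z =
      (1 + zResolvent M z⁻¹ * cplx M) * cplx U * (1 + cplx N * zResolvent N z) := by
    rw [← h2]
    conv_lhs => rw [h4]
    simp only [Matrix.smul_mul, Matrix.mul_smul]
  have h6 : zResolvent M z⁻¹ * cplx Q * zResolvent N z =
      zResolvent M z⁻¹ * cplx U * zResolvent N z -
        zResolvent M z⁻¹ * cplx M * cplx U * (cplx N * zResolvent N z) := by
    rw [h1]; simp only [Matrix.mul_sub, Matrix.sub_mul, Matrix.mul_assoc]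
  rw [h6, h5, h2]
  simp only [Matrix.mul_add, Matrix.add_mul, Matrix.mul_assoc, Matrix.one_mul, Matrix.mul_one]
  abel

variable {dx du ds n : ℕ} {A : Matrix (Fin dx) (Fin dx) ℝ} {Bu : Matrix (Fin dx) (Fin du) ℝ}
  {Bw : Matrix (Fin dx) (Fin 1) ℝ} {C : Matrix (Fin ds) (Fin dx) ℝ}
  {P : Matrix (Fin dx) (Fin dx) ℝ} {R : Matrix (Fin du) (Fin du) ℝ}
  {At : Matrix (Fin n) (Fin n) ℝ} {Bt : Matrix (Fin n) (Fin 1) ℝ} {Ct : Matrix (Fin 1) (Fin n) ℝ}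
  {Ut : Matrix (Fin dx) (Fin n) ℝ} {L : ℂ → ℂ} {Dt : ℝ}

/-- The causal part of `L` times the strictly anticausal part of `Δ K_∘`. -/
noncomputable def filteredPart (Bu : Matrix (Fin dx) (Fin du) ℝ) (P : Matrix (Fin dx) (Fin dx) ℝ)
    (R : Matrix (Fin du) (Fin du) ℝ) (At : Matrix (Fin n) (Fin n) ℝ) (Bt : Matrix (Fin n) (Fin 1) ℝ)
    (Ut : Matrix (Fin dx) (Fin n) ℝ) (Dt : ℝ) (z : ℂ) : Matrix (Fin du) (Fin 1) ℂ :=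
  (Real.sqrt Dt : ℂ) •
    -(cplx (R * gainInv Bu P * Buᵀ * Ut) * (z • zResolvent At z) * cplx Bt)

/-- The product `T C̃ (zI - Ã)⁻¹ B̃` contains the two-sided resolvent product with `Q = A_k* P B_w
C̃`, split by `Ũ`. Its anticausal summand joins `T` itself to give the term in `P B_w + Ũ B̃`. -/
theorem isCausalPart_filteredPart (hP : IsStabilizingRiccati A Bu C P)
    (hL : IsFactorRealization L At Bt Ct Dt) (hU : IsSteinSolution A Bu Bw P At Ct Ut) :
    IsCausalPart (fun z => L z • anticausalPart A Bu Bw P R z)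
      (filteredPart Bu P R At Bt Ut Dt) := by
  obtain ⟨hAt, -, -, hLz⟩ := hL
  refine ⟨isCausal_iff.2
      (((hAt.isAbsSeries_smul_zResolvent.mul_left _).mul_right _).neg.smul _),
    fun z => (Real.sqrt Dt : ℂ) • -(cplx (R * gainInv Bu P * Buᵀ) *
      zResolvent (closedLoop A Bu P)ᵀ z⁻¹ * cplx ((closedLoop A Bu P)ᵀ * (P * Bw + Ut * Bt))),
    isStrictlyAnticausal_iff.2
      (((hP.2.2.2.transpose.isAbsSeries_zResolvent_inv.mul_left _).mul_right _).neg.smul _),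
    fun z hz => ?_⟩
  have hz0 : z ≠ 0 := by rintro rfl; simp at hz
  have h1 := zResolvent_inv_mul_mul_zResolvent hz0
    (hP.2.2.2.transpose.notMem (z := z⁻¹) (by simp [hz])) (hAt.notMem hz) hU
  have h2 : ∀ X : Matrix (Fin du) (Fin 1) ℂ, L z • X =
      (Real.sqrt Dt : ℂ) • (X + X * (cplx Ct * zResolvent At z * cplx Bt)) := fun X => by
    rw [hLz z hz, mul_fin_one, mul_comm, mul_smul, add_smul, one_smul]
  have h3 := congrArg (fun M => cplx (R * gainInv Bu P * Buᵀ) * M * cplx Bt) h1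
  beta_reduce
  rw [h2, filteredPart, anticausalPart, ← smul_add]
  congr 1
  simp only [cplx_mul, cplx_add, Matrix.mul_add, Matrix.add_mul, Matrix.mul_assoc, Matrix.neg_mul]
    at h3 ⊢
  rw [h3]
  abel

theorem cplx_fromRows {ι κ l : Type*} (M : Matrix ι l ℝ) (N : Matrix κ l ℝ) :
    cplx (Matrix.fromRows M N) = Matrix.fromRows (cplx M) (cplx N) := by
  ext (_ | _) _ <;> rfl

theorem cplx_fromCols {ι κ l : Type*} (M : Matrix l ι ℝ) (N : Matrix l κ ℝ) :
    cplx (Matrix.fromCols M N) = Matrix.fromCols (cplx M) (cplx N) := by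
  ext _ (_ | _) <;> rfl

theorem isSchur_ctrlF (hP : IsStabilizingRiccati A Bu C P)
    (hL : IsFactorRealization L At Bt Ct Dt) : IsSchur (ctrlF A Bu P At Bt Ct Ut) :=
  hL.2.1.fromBlocks hP.2.2.2 _

/-- The transfer function of the state-space controller. -/
theorem ctrl_transfer_eq (hP : IsStabilizingRiccati A Bu C P)
    (hL : IsFactorRealization L At Bt Ct Dt) {z : ℂ} (hz : ‖z‖ = 1) :
    cplx (ctrlH A Bu P Ut) * zResolvent (ctrlF A Bu P At Bt Ct Ut) z *
        cplx (ctrlG Bu Bw P At Bt Ct Ut) + cplx (ctrlJ Bu Bw P Bt Ut) =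
      h2Law A Bu Bw P z - returnDiffInv A Bu P z * (cplx (gainInv Bu P * Buᵀ * Ut) *
        (z • zResolvent (At - Bt * Ct) z * cplx Bt)) := by
  -- `E₁` and `E₂` are the two blocks of the controller state, found by forward substitution in the
  -- block triangular system. The control is `K_lqr E₂ - h`, so `E₂` is minus the plant state.
  let E₁ : Matrix (Fin n) (Fin 1) ℂ := zResolvent (At - Bt * Ct) z * cplx ((At - Bt * Ct) * Bt)
  let h : Matrix (Fin du) (Fin 1) ℂ :=
    cplx (feedthrough Bu Bw P) + cplx (gainInv Bu P * Buᵀ * Ut) * (cplx Bt + E₁)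
  let E₂ : Matrix (Fin dx) (Fin 1) ℂ :=
    zResolvent (closedLoop A Bu P) z * (cplx Bu * h - cplx Bw)
  have hE₁ : z • zResolvent (At - Bt * Ct) z * cplx Bt = cplx Bt + E₁ := by
    rw [smul_zResolvent' (hL.2.1.notMem hz), Matrix.add_mul, Matrix.one_mul, Matrix.mul_assoc,
      ← cplx_mul]
  have hE₂ : (z • (1 : Matrix (Fin dx) (Fin dx) ℂ) - cplx (closedLoop A Bu P)) * E₂ =
      cplx Bu * h - cplx Bw := by
    rw [← Matrix.mul_assoc, sub_mul_zResolvent (hP.notMem hz), Matrix.one_mul]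
  have hE : zResolvent (ctrlF A Bu P At Bt Ct Ut) z * cplx (ctrlG Bu Bw P At Bt Ct Ut) =
      Matrix.fromRows E₁ E₂ := by
    have h1 : (z • (1 : Matrix (Fin n ⊕ Fin dx) (Fin n ⊕ Fin dx) ℂ) -
        cplx (ctrlF A Bu P At Bt Ct Ut)) * Matrix.fromRows E₁ E₂ =
          cplx (ctrlG Bu Bw P At Bt Ct Ut) := by
      have h2 : z • (1 : Matrix (Fin n ⊕ Fin dx) (Fin n ⊕ Fin dx) ℂ) -
          cplx (ctrlF A Bu P At Bt Ct Ut) = Matrix.fromBlocks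
            (z • (1 : Matrix (Fin n) (Fin n) ℂ) - cplx (At - Bt * Ct)) 0
            (-cplx (Bu * gainInv Bu P * Buᵀ * Ut))
            (z • (1 : Matrix (Fin dx) (Fin dx) ℂ) - cplx (closedLoop A Bu P)) := by
        rw [ctrlF, cplx_fromBlocks, ← Matrix.fromBlocks_one, Matrix.fromBlocks_smul, cplx_zero,
          sub_eq_add_neg, Matrix.fromBlocks_neg, Matrix.fromBlocks_add]
        simp [sub_eq_add_neg]
      rw [h2, Matrix.fromBlocks_mul_fromRows, ctrlG, cplx_fromRows]
      congr 1
      · rw [← Matrix.mul_assoc, sub_mul_zResolvent (hL.2.1.notMem hz), Matrix.one_mul,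
          Matrix.zero_mul, add_zero]
      · rw [hE₂, Matrix.neg_mul]
        simp only [h, feedthrough, cplx_mul, cplx_add, cplx_neg, Matrix.mul_add,
          Matrix.mul_assoc]
        abel
    rw [← h1, ← Matrix.mul_assoc, zResolvent_mul_sub ((isSchur_ctrlF hP hL).notMem hz),
      Matrix.one_mul]
  rw [Matrix.mul_assoc, hE, ctrlH, cplx_fromCols, Matrix.fromCols_mul_fromRows, hE₁, h2Law, h2State,
    returnDiffInv, ctrlJ]
  simp only [E₂, h, feedthrough, cplx_mul, cplx_add, cplx_sub, cplx_neg, Matrix.mul_add,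
    Matrix.mul_sub, Matrix.sub_mul, Matrix.one_mul, Matrix.neg_mul, Matrix.mul_assoc]
  abel

/-- Since `√D̃ (zI - Ã)⁻¹ B̃ = L (zI - Ã + B̃ C̃)⁻¹ B̃`, the scalar `L` factors out of the filtered
part and cancels. -/
theorem inv_smul_filteredPart (hP : IsStabilizingRiccati A Bu C P) (hR : IsUnit R.det)
    (hL : IsFactorRealization L At Bt Ct Dt) {z : ℂ} (hz : IsRegularPoint A z) :
    (L z)⁻¹ • ((riccatiFactor A Bu P R z)⁻¹ * filteredPart Bu P R At Bt Ut Dt z) =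
      -(returnDiffInv A Bu P z * (cplx (gainInv Bu P * Buᵀ * Ut) *
        (z • zResolvent (At - Bt * Ct) z * cplx Bt))) := by
  obtain ⟨hAt, hAtk, hDt, hLz⟩ := hL
  have h1 := zResolvent_mul_returnDifference' (hAt.notMem hz.1) (hAtk.notMem hz.1)
    (rfl : At - Bt * Ct = At - Bt * Ct)
  rw [mul_fin_one, Matrix.add_apply, Matrix.one_apply_eq] at h1
  have h2 := congrFun (congrFun (returnDifference_mul (hAt.notMem hz.1) (hAtk.notMem hz.1)
    (rfl : At - Bt * Ct = At - Bt * Ct)) 0) 0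
  rw [Matrix.mul_apply, Fin.sum_univ_one, Matrix.add_apply, Matrix.one_apply_eq] at h2
  have hL0 : L z ≠ 0 := by
    rw [hLz z hz.1]
    refine mul_ne_zero (left_ne_zero_of_mul_eq_one h2) ?_
    exact_mod_cast (Real.sqrt_pos.2 hDt).ne'
  have h3 : (Real.sqrt Dt : ℂ) • (zResolvent At z * cplx Bt) =
      L z • (zResolvent (At - Bt * Ct) z * cplx Bt) := by
    rw [← h1, smul_smul, hLz z hz.1, mul_comm]
  have h4 : filteredPart Bu P R At Bt Ut Dt z =
      L z • -(cplx R * (cplx (gainInv Bu P * Buᵀ * Ut) *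
        (z • zResolvent (At - Bt * Ct) z * cplx Bt))) := by
    have h5 : filteredPart Bu P R At Bt Ut Dt z = -(cplx R * (cplx (gainInv Bu P * Buᵀ * Ut) *
        (z • ((Real.sqrt Dt : ℂ) • (zResolvent At z * cplx Bt))))) := by
      simp only [filteredPart, cplx_mul, Matrix.smul_mul, Matrix.mul_smul, smul_neg,
        Matrix.mul_assoc, smul_comm z]
    rw [h5, h3]
    simp only [Matrix.smul_mul, Matrix.mul_smul, smul_neg, smul_comm z]
  rw [h4, Matrix.mul_smul, smul_smul, inv_mul_cancel₀ hL0, one_smul, riccatiFactor_inv hP hR hz,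
    Matrix.mul_neg, Matrix.mul_assoc, ← Matrix.mul_assoc (cplx R⁻¹), cplx_inv_mul hR,
    Matrix.one_mul]

/-- The state-space controller is the controller. -/
theorem isController_ctrl (hP : IsStabilizingRiccati A Bu C P) (hPd : P.PosDef)
    (hL : IsFactorRealization L At Bt Ct Dt) (hU : IsSteinSolution A Bu Bw P At Ct Ut) :
    IsController A Bu Bw C L fun z =>
      cplx (ctrlH A Bu P Ut) * zResolvent (ctrlF A Bu P At Bt Ct Ut) z *
        cplx (ctrlG Bu Bw P At Bt Ct Ut) + cplx (ctrlJ Bu Bw P Bt Ut) := by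
  obtain ⟨R, hR⟩ := exists_transpose_mul_self_eq (Bu := Bu) hPd
  have hRu := isUnit_det_of_transpose_mul_self hP hR
  refine ⟨⟨_, hasMarkovParameters_markov (isSchur_ctrlF hP hL) fun _ _ => rfl⟩,
    riccatiFactor A Bu P R, _, _, _, isCanonicalFactor_riccatiFactor hP hR,
    isPlantSplit_riccatiFactor hP, isCausalPart_filteredPart hP hL hU, fun z hz => ?_⟩
  beta_reduce
  rw [inv_smul_filteredPart hP hRu hL hz, ctrl_transfer_eq hP hL hz.1,
    Matrix.nonsing_inv_mul_cancel_left, sub_eq_add_neg]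
  refine Matrix.isUnit_det_of_right_inverse (B := returnDiffInv A Bu P z * cplx R⁻¹) ?_
  rw [riccatiFactor, Matrix.mul_assoc, ← Matrix.mul_assoc (returnDiff A Bu P z),
    hP.returnDiff_mul hz, Matrix.one_mul, cplx_mul_inv hRu]

end Realization

theorem lemma6 {dx du ds : ℕ}
    (A : Matrix (Fin dx) (Fin dx) ℝ) (Bu : Matrix (Fin dx) (Fin du) ℝ)
    (Bw : Matrix (Fin dx) (Fin 1) ℝ) (C : Matrix (Fin ds) (Fin dx) ℝ)
    (hstab : IsStabilizable A Bu) (hobs : IsObservable A C)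
    (m : ℕ) (p q : ℕ → ℝ) (hp : IsPositiveTrigPoly m p) (hq : IsPositiveTrigPoly m q)
    (L : ℂ → ℂ) (hL : IsRationalSpectralFactor m p q L) :
    -- the controller exists
    (∃ K : ℂ → Matrix (Fin du) (Fin 1) ℂ, IsController A Bu Bw C L K) ∧
    -- the factor has a realization of order `m`
    (∃ (At : Matrix (Fin m) (Fin m) ℝ) (Bt : Matrix (Fin m) (Fin 1) ℝ)
      (Ct : Matrix (Fin 1) (Fin m) ℝ) (Dt : ℝ), IsFactorRealization L At Bt Ct Dt) ∧
    -- the Riccati equation has exactly one stabilizing solution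
    ∃ P : Matrix (Fin dx) (Fin dx) ℝ, P.PosDef ∧ IsStabilizingRiccati A Bu C P ∧
      (∀ P' : Matrix (Fin dx) (Fin dx) ℝ, IsStabilizingRiccati A Bu C P' → P' = P) ∧
      -- the controller is rational, with the explicit realization
      ∀ K : ℂ → Matrix (Fin du) (Fin 1) ℂ, IsController A Bu Bw C L K →
        IsRational K ∧
        ∀ (n : ℕ) (At : Matrix (Fin n) (Fin n) ℝ) (Bt : Matrix (Fin n) (Fin 1) ℝ)
          (Ct : Matrix (Fin 1) (Fin n) ℝ) (Dt : ℝ), IsFactorRealization L At Bt Ct Dt →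
          ∃ Ut : Matrix (Fin dx) (Fin n) ℝ, IsSteinSolution A Bu Bw P At Ct Ut ∧
            (∀ Ut' : Matrix (Fin dx) (Fin n) ℝ, IsSteinSolution A Bu Bw P At Ct Ut' → Ut' = Ut) ∧
            IsSchur (ctrlF A Bu P At Bt Ct Ut) ∧
            (∀ z : ℂ, ‖z‖ = 1 →
              K z = cplx (ctrlH A Bu P Ut) * zResolvent (ctrlF A Bu P At Bt Ct Ut) z *
                  cplx (ctrlG Bu Bw P At Bt Ct Ut) + cplx (ctrlJ Bu Bw P Bt Ut)) ∧
            ∃ Kh : ℕ → Matrix (Fin du) (Fin 1) ℝ,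
              HasMarkovParameters K (fun k => cplx (Kh k)) ∧
              IsRealizedBy Kh (ctrlF A Bu P At Bt Ct Ut) (ctrlG Bu Bw P At Bt Ct Ut)
                (ctrlH A Bu P Ut) (ctrlJ Bu Bw P Bt Ut) := by

  obtain ⟨P, hPd, hP⟩ := exists_posDef_isStabilizingRiccati hstab hobs
  have hstein : ∀ {n : ℕ} {At : Matrix (Fin n) (Fin n) ℝ} (Ct : Matrix (Fin 1) (Fin n) ℝ),
      IsSchur At → ∃! Ut, IsSteinSolution A Bu Bw P At Ct Ut := fun Ct hAt =>
    existsUnique_stein hP.2.2.2.transpose hAt _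
  -- The order `m` realization yields existence and rationality; an arbitrary realization also gives
  -- a controller, which uniqueness identifies with `K`.
  obtain ⟨At, Bt, Ct, Dt, hfac⟩ := exists_isFactorRealization hL
  obtain ⟨Ut, hUt, -⟩ := hstein Ct hfac.1
  have hctrl := isController_ctrl hP hPd hfac hUt
  refine ⟨⟨_, hctrl⟩, ⟨At, Bt, Ct, Dt, hfac⟩, P, hPd, hP, fun P' hP' => hP.unique hP',
    fun K hK => ⟨isRational_of_eq (isSchur_ctrlF hP hfac) fun z hz => hK.unique hctrl hz, ?_⟩⟩
  intro n At Bt Ct Dt hfac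
  obtain ⟨Ut, hUt, huniq⟩ := hstein Ct hfac.1
  have hF : IsSchur (ctrlF A Bu P At Bt Ct Ut) := isSchur_ctrlF hP hfac
  have hKeq := fun z hz => hK.unique (isController_ctrl hP hPd hfac hUt) (z := z) hz
  exact ⟨Ut, hUt, huniq, hF, hKeq, _, hasMarkovParameters_markov hF hKeq, isRealizedBy_markov hF⟩
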